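/- Conventions. $|x|$ is the Euclidean norm, $f\sim g$ means $f/g\to1$, and $|0|^0=1$. A function on $\mathbb Z^d$ is symmetric if it is invariant under permutations and sign changes of coordinates. For $f:\mathbb Z^d\to\mathbb R$ let $\hat f(k)=\sum_x f(x)e^{-ik\cdot x}$, $f^{(\mu)}(x)=f(x)e^{\mu\cdot x}$ ($\mu\in\mathbb R^d$), and $\|f\|_p$ the $\ell^p(\mathbb Z^d)$ norm. For $S:\mathbb Z^d\to[0,\infty)$ let $\Omega=\{\mu\in\mathbb R^d:\sum_x S^{(\mu)}(x)<\infty\}$ and $m=\sup\{t\ge0: te_1\in\Omega\}$. For $M,K,\zeta>0$, the class $\mathcal Q_{M,K,\zeta}$ consists of the pairs $(Q,g)$ of functions $\mathbb Z^d\to\mathbb R$ such that each of $\|Q\|_1$, $\||y|^{2+\zeta}Q(y)\|_1$, $\|g\|_1$, $\||y|^\zeta g(y)\|_1$, $\||y|^2g(y)\|_{p_d\wedge2}$ is at most $M$, where $p_1=2$ and $p_d=d/(d-2+(\zeta\wedge2))$ for $d\ge2$; such that $\operatorname{Re}[\hat Q(0)-\hat Q(k)]\ge K|k|^2$ for all $k\in[-\pi,\pi]^d$;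 and such that, if $d\ge4$, also $\||y|^{d-1}Q(y)\|_{\frac d3\wedge2}\le M$ and $\||y|^{d-1}g(y)\|_2\le M$. Theorem. Let $d\ge1$, $z_c\in\mathbb R$ and $\delta>0$, and for $z\in[z_c-\delta,z_c]$ let $S_z,J_z,h_z:\mathbb Z^d\to\mathbb R$, with $\Omega_z$ and $m_z$ defined from $S_z$, such that for each $z\in[z_c-\delta,z_c)$: (a) $S_z\ge0$ is symmetric, $\Omega_z$ is open and contains $0$, and $\mu_1e_1\notin\Omega_z$ for some $\mu_1>0$; (b) $J_z,h_z\in\ell^1(\mathbb Z^d)$ are symmetric, $S_z=h_z+J_z*S_z$, there are constants $M',K',\zeta'>0$ (which may depend on $z$) with $(J_z^{(\mu)},h_z^{(\mu)})\in\mathcal Q_{M',K',\zeta'}$ for all $\mu\in\overline{\Omega_z}$, and $\hat h_z^{(\mu)}(0)>0$ for all $\mu\in\overline{\Omega_z}$. Suppose that $m_z\to0$ as $z\uparrow z_c$, and that there are constants $M,K,\zeta>0$ with $(J_z^{(\mu)},h_z^{(\mu)})\in\mathcal Q_{M,K,\zeta}$ and $\hat h_z^{(\mu)}(0)\ge M^{-1}$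 for all $z\in[z_c-\delta,z_c)$ and all $\mu\in\overline{\Omega_z}$. Let $\sigma_z\ge0$ be given by $\sigma_z^2=\sum_x|x|^2J_z(x)$, and suppose that $\sigma_z\to\sigma_{z_c}$ and $\hat h_z(0)\to\hat h_{z_c}(0)$ as $z\uparrow z_c$. For $\phi\ge0$ let $$A_\phi=\int_{\mathbb R^d}|y|^\phi\,\mathsf G_1(y)\,dy,\qquad \mathsf G_1(y)=\int_0^\infty(2\pi t)^{-d/2}e^{-|y|^2/(2t)}e^{-t/2}\,dt,$$ and for $\phi>0$ let $\xi_\phi(z)=\bigl(\chi(z)^{-1}\sum_x|x|^\phi S_z(x)\bigr)^{1/\phi}$, where $\chi(z)=\sum_xS_z(x)$. Then: 1. For every $\phi\ge0$, $\displaystyle A_\phi=2^{\phi+1}\frac{\Gamma(\frac{\phi+2}2)\Gamma(\frac{\phi+d}2)}{\Gamma(\frac d2)}$. 2. For every $\phi\ge0$, the sum $\sum_x|x|^\phi S_z(x)$ converges for every $z\in[z_c-\delta,z_c)$, and, as $z\uparrow z_c$, $$\sum_{x\in\mathbb Z^d}|x|^\phi S_z(x)\sim A_\phi\,\frac{d\,\hat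 h_{z_c}(0)}{\sigma_{z_c}^2}\,\frac1{m_z^{2+\phi}}.$$ 3. For every $\phi>0$, as $z\uparrow z_c$, $$\xi_\phi(z)\sim\Bigl(\frac{A_\phi}{A_0}\Bigr)^{1/\phi}\frac1{m_z},\qquad \Bigl(\frac{A_\phi}{A_0}\Bigr)^{1/\phi}=2\left(\frac{\Gamma(\frac{\phi+2}2)\Gamma(\frac{\phi+d}2)}{\Gamma(\frac d2)}\right)^{1/\phi}.$$ 4. For all $\phi,\psi>0$, $$\lim_{z\uparrow z_c}\frac{\xi_\phi(z)}{\xi_\psi(z)}=\frac{[\Gamma(\frac{\phi+2}2)\Gamma(\frac{\phi+d}2)]^{1/\phi}}{[\Gamma(\frac{\psi+2}2)\Gamma(\frac{\psi+d}2)]^{1/\psi}}\,\Gamma\Bigl(\frac d2\Bigr)^{\frac1\psi-\frac1\phi}.$$ -/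

import Mathlib

open Filter Topology MeasureTheory

namespace OZ

/-- Points of the lattice `ℤ^d`, viewed in Euclidean space `ℝ^d`. -/
noncomputable def toE {d : ℕ} (x : Fin d → ℤ) : EuclideanSpace ℝ (Fin d) :=
  WithLp.toLp 2 (fun i => (x i : ℝ))

/-- `ℤ^d`-symmetry: invariance under a sign change of a coordinate and under permutations of
the coordinates. -/
def LatticeSymmetric {d : ℕ} (f : (Fin d → ℤ) → ℝ) : Prop :=
  (∀ (x : Fin d → ℤ) (i : Fin d), f (Function.update x i (-x i)) = f x) ∧
  (∀ (x : Fin d → ℤ) (π : Equiv.Perm (Fin d)), f (x ∘ π) = f x)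

/-- The exponential tilt `f^(μ)(x) = f(x) e^{μ·x}`. -/
noncomputable def tilt {d : ℕ} (f : (Fin d → ℤ) → ℝ) (μ : EuclideanSpace ℝ (Fin d))
    (x : Fin d → ℤ) : ℝ :=
  f x * Real.exp (inner ℝ μ (toE x))

/-- The Fourier transform `f̂(k) = ∑_x f(x) e^{-ik·x}`. -/
noncomputable def fourier {d : ℕ} (f : (Fin d → ℤ) → ℝ) (k : EuclideanSpace ℝ (Fin d)) : ℂ :=
  ∑' x : Fin d → ℤ, (f x : ℂ) * Complex.exp (-(Complex.I * ((inner ℝ k (toE x) : ℝ) : ℂ)))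

/-- The real number `f̂(0)`. -/
noncomputable def hatZero {d : ℕ} (f : (Fin d → ℤ) → ℝ) : ℝ :=
  (fourier f 0).re

theorem fourier_zero {d : ℕ} (f : (Fin d → ℤ) → ℝ) :
    fourier f 0 = ((∑' x : Fin d → ℤ, f x : ℝ) : ℂ) := by
  simp [fourier, Complex.ofReal_tsum]

theorem hatZero_eq_tsum {d : ℕ} (f : (Fin d → ℤ) → ℝ) :
    hatZero f = ∑' x : Fin d → ℤ, f x := by
  rw [hatZero, fourier_zero, Complex.ofReal_re]

/-- The `ℓ^p(ℤ^d)` norm of `y ↦ |y|^a f(y)`, with value `∞` if it diverges. -/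
noncomputable def weightedNorm {d : ℕ} (a p : ℝ) (f : (Fin d → ℤ) → ℝ) : ENNReal :=
  eLpNorm (fun y : Fin d → ℤ => ‖toE y‖ ^ a * f y) (ENNReal.ofReal p) Measure.count

/-- The exponent `p_d`, equal to `2` for `d = 1` and to `d / (d - 2 + (ζ ∧ 2))` for `d ≥ 2`. -/
noncomputable def pExp (d : ℕ) (ζ : ℝ) : ℝ :=
  if d = 1 then 2 else (d : ℝ) / ((d : ℝ) - 2 + min ζ 2)

/-- The class `𝒬_{M,K,ζ}` of pairs `(Q, g)` of functions on `ℤ^d`. The torus of period `2π` is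
represented by `[-π, π]^d`. -/
structure QClass {d : ℕ} (M K ζ : ℝ) (Q g : (Fin d → ℤ) → ℝ) : Prop where
  Q_norm : weightedNorm 0 1 Q ≤ ENNReal.ofReal M
  Q_moment : weightedNorm (2 + ζ) 1 Q ≤ ENNReal.ofReal M
  infrared : ∀ k : EuclideanSpace ℝ (Fin d), (∀ i, |k i| ≤ Real.pi) →
    K * ‖k‖ ^ 2 ≤ (fourier Q 0 - fourier Q k).re
  g_norm : weightedNorm 0 1 g ≤ ENNReal.ofReal M
  g_moment : weightedNorm ζ 1 g ≤ ENNReal.ofReal M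
  g_moment_two : weightedNorm 2 (min (pExp d ζ) 2) g ≤ ENNReal.ofReal M
  Q_high : 4 ≤ d → weightedNorm ((d : ℝ) - 1) (min ((d : ℝ) / 3) 2) Q ≤ ENNReal.ofReal M
  g_high : 4 ≤ d → weightedNorm ((d : ℝ) - 1) 2 g ≤ ENNReal.ofReal M

/-- The set `Ω = {μ : χ^(μ) < ∞}`, where `χ^(μ) = ∑_x S^(μ)(x)`. For a nonnegative `S`,
finiteness of the sum is summability. -/
def Omega {d : ℕ} (S : (Fin d → ℤ) → ℝ) : Set (EuclideanSpace ℝ (Fin d)) :=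
  {μ | Summable (tilt S μ)}

/-- The vector `t e_1`. -/
noncomputable def e1 {d : ℕ} [NeZero d] (t : ℝ) : EuclideanSpace ℝ (Fin d) :=
  EuclideanSpace.single 0 t

/-- The mass `m_S = sup {t ≥ 0 : χ^(t e_1) < ∞}`. -/
noncomputable def mass {d : ℕ} [NeZero d] (S : (Fin d → ℤ) → ℝ) : ℝ :=
  sSup {t : ℝ | 0 ≤ t ∧ e1 t ∈ Omega S}

/-- `S` is nonnegative, symmetric, and decays exponentially in an averaged sense, but not
arbitrarily fast. -/
structure ExpDecay {d : ℕ} [NeZero d] (S : (Fin d → ℤ) → ℝ) : Prop where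
  nonneg : ∀ x, 0 ≤ S x
  symm : LatticeSymmetric S
  isOpen : IsOpen (Omega S)
  zero_mem : (0 : EuclideanSpace ℝ (Fin d)) ∈ Omega S
  exists_not_mem : ∃ t : ℝ, 0 < t ∧ e1 t ∉ Omega S

/-- `S` obeys the generalised Ornstein–Zernike equation `S = h + J * S`, with symmetric
`J, h ∈ L¹` whose tilts by `μ ∈ closure Ω` lie in one class `𝒬` and satisfy `ĥ^(μ)(0) > 0`. -/
structure OZEquation {d : ℕ} (S J h : (Fin d → ℤ) → ℝ) : Prop where
  J_symm : LatticeSymmetric J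
  h_symm : LatticeSymmetric h
  J_summable : Summable (fun x => |J x|)
  h_summable : Summable (fun x => |h x|)
  eqn : ∀ x, S x = h x + ∑' y : Fin d → ℤ, J (x - y) * S y
  tilts : ∃ M K ζ : ℝ, 0 < M ∧ 0 < K ∧ 0 < ζ ∧
    ∀ μ ∈ closure (Omega S), QClass M K ζ (tilt J μ) (tilt h μ)
  hat_pos : ∀ μ ∈ closure (Omega S), 0 < hatZero (tilt h μ)

/-- `σ`, where `σ² = ∑_x |x|² J(x)`. -/
noncomputable def sigma {d : ℕ} (J : (Fin d → ℤ) → ℝ) : ℝ :=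
  Real.sqrt (∑' x : Fin d → ℤ, ‖toE x‖ ^ 2 * J x)

/-- The moment `∑_x |x|^φ S(x)` (with `|0|^0 = 1`). -/
noncomputable def moment {d : ℕ} (φ : ℝ) (S : (Fin d → ℤ) → ℝ) : ℝ :=
  ∑' x : Fin d → ℤ, ‖toE x‖ ^ φ * S x

/-- The susceptibility `χ = ∑_x S(x)`. -/
noncomputable def susceptibility {d : ℕ} (S : (Fin d → ℤ) → ℝ) : ℝ :=
  ∑' x : Fin d → ℤ, S x

/-- The correlation length of order `φ`. -/
noncomputable def corrLength {d : ℕ} (φ : ℝ) (S : (Fin d → ℤ) → ℝ) : ℝ :=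
  (1 / susceptibility S * moment φ S) ^ (1 / φ)

/-- The massive continuum Green function
`G_a(x) = ∫_0^∞ (2πt)^{-d/2} e^{-|x|²/(2t)} e^{-ta²/2} dt`. -/
noncomputable def massiveGreen {d : ℕ} (a : ℝ) (x : EuclideanSpace ℝ (Fin d)) : ℝ :=
  ∫ t in Set.Ioi (0 : ℝ), 1 / (2 * Real.pi * t) ^ ((d : ℝ) / 2) *
    Real.exp (-(1 / (2 * t)) * ‖x‖ ^ 2) * Real.exp (-(1 / 2) * t * a ^ 2)

/-- The constant `A_φ = ∫_{ℝ^d} |y|^φ G_1(y) dy`. -/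
noncomputable def constA (d : ℕ) (φ : ℝ) : ℝ :=
  ∫ y : EuclideanSpace ℝ (Fin d), ‖y‖ ^ φ * massiveGreen 1 y

end OZ

/-! Normalise `S_z` to a probability on `ℤ^d` and rescale space by `m = m_z`. As `m → 0` this law
converges weakly to the law with density `G_1 / 2`, whose characteristic function is `1 / (1 +
|ξ|²)` (`charFun_greenLaw`), and moments of every order converge too.

The characteristic function of the rescaled law is `Ŝ(mξ) / χ`, and the convolution equation gives
`Ŝ(k) (1 - Ĵ(k)) = ĥ(k)` (`cosSum_mul`). Everything rests on the behaviour of `1 - Ĵ(mξ)`. Since `S`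
tilted by `m e_1` has just stopped being summable while the tilted `h` stays bounded, the tilted `J`
must have total mass exactly one: `∑ J(x) e^{m x_1} = 1` (`expSum_J_mass`). Writing the `1` in this
way, `1 - Ĵ(mξ) = ∑ J(x) (cosh(m x_1) - 1) + ∑ J(x) (1 - cos(mξ·x))`, and by lattice symmetry the
two sums are `m² σ² / (2d)` and `m² |ξ|² σ² / (2d)` up to errors `O(m^{2+η})`, with `η = min ζ 1`
(`abs_expSum_sub_le`, `abs_sub_cosSum_sub_le`). Hence `m² Ŝ(mξ) → (2 d ĥ(0) / σ²) / (1 + |ξ|²)`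
(`tendsto_cosSum_S`); the case `ξ = 0` is the asymptotics of `χ`, and the quotient gives the
characteristic function.

Lévy's theorem yields weak convergence. To pass to the unbounded function `|y|^φ` it suffices to
bound the moment of order `2φ` (`tendsto_tsum_of_tendsto_charFun`). That moment is controlled by
exponential moments at rate `m/2`, and `χ^{(m e_1 / 2)} = O(m^{-2})` because `1 - Ĵ^{(m e_1 /
2)}(0)` is still of order `m²` (`exists_expSum_S_le`). The constants `A_φ` are Gaussian moments
integrated over time (`constA_eq`). -/

namespace OZ

variable {d : ℕ}

/-! ### Moments and Fourier transform of the continuum Green function. -/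

/-- The heat kernel with killing rate `1/2`, so that `massiveGreen 1` is its time integral. -/
noncomputable def killedHeat (t : ℝ) (y : EuclideanSpace ℝ (Fin d)) : ℝ :=
  1 / (2 * Real.pi * t) ^ ((d : ℝ) / 2) *
    Real.exp (-(1 / (2 * t)) * ‖y‖ ^ 2) * Real.exp (-(1 / 2) * t)

theorem massiveGreen_one (y : EuclideanSpace ℝ (Fin d)) :
    massiveGreen 1 y = ∫ t in Set.Ioi (0 : ℝ), killedHeat t y := by
  simp [massiveGreen, killedHeat]

theorem killedHeat_nonneg {t : ℝ} (ht : 0 < t) (y : EuclideanSpace ℝ (Fin d)) :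
    0 ≤ killedHeat t y := by
  unfold killedHeat; positivity

theorem massiveGreen_one_nonneg (y : EuclideanSpace ℝ (Fin d)) : 0 ≤ massiveGreen 1 y := by
  rw [massiveGreen_one]
  exact setIntegral_nonneg measurableSet_Ioi fun t ht => killedHeat_nonneg ht y

theorem measurable_killedHeat :
    Measurable fun p : EuclideanSpace ℝ (Fin d) × ℝ => killedHeat p.2 p.1 := by
  unfold killedHeat
  fun_prop

theorem integrable_norm_rpow_mul_gaussian [NeZero d] {φ b : ℝ} (hφ : 0 ≤ φ) (hb : 0 < b) :
    Integrable fun y : EuclideanSpace ℝ (Fin d) => ‖y‖ ^ φ * Real.exp (-b * ‖y‖ ^ 2) := by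
  have hd : (1 : ℝ) ≤ d := by exact_mod_cast NeZero.one_le
  refine (integrable_fun_norm_addHaar (E := EuclideanSpace ℝ (Fin d)) volume
    (f := fun r : ℝ => r ^ φ * Real.exp (-b * r ^ 2))).2 ?_
  refine (integrableOn_rpow_mul_exp_neg_mul_sq hb (s := (d : ℝ) - 1 + φ) (by linarith)).congr_fun
    (fun r hr => ?_) measurableSet_Ioi
  have hr' : (0 : ℝ) < r := hr
  simp only [finrank_euclideanSpace, Fintype.card_fin, smul_eq_mul]
  rw [Real.rpow_add hr', ← mul_assoc, ← Real.rpow_natCast r (d - 1), Nat.cast_sub NeZero.one_le,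
    Nat.cast_one]

/-- Polar coordinates reduce this to a Gamma integral in the radius. The volume of the unit ball
contributes `Γ(d/2 + 1) = (d/2) Γ(d/2)`, which absorbs the dimension factor. -/
theorem integral_norm_rpow_mul_gaussian [NeZero d] {φ b : ℝ} (hφ : 0 ≤ φ) (hb : 0 < b) :
    ∫ y : EuclideanSpace ℝ (Fin d), ‖y‖ ^ φ * Real.exp (-b * ‖y‖ ^ 2) =
      Real.pi ^ ((d : ℝ) / 2) * b ^ (-((φ + d) / 2)) * Real.Gamma ((φ + d) / 2) /
        Real.Gamma ((d : ℝ) / 2) := by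
  have hd : (1 : ℝ) ≤ d := by exact_mod_cast NeZero.one_le
  have := integral_fun_norm_addHaar (E := EuclideanSpace ℝ (Fin d)) volume
    (fun r : ℝ => r ^ φ * Real.exp (-b * r ^ 2))
  rw [this]
  have h1 : ∫ r in Set.Ioi (0 : ℝ), r ^ (Module.finrank ℝ (EuclideanSpace ℝ (Fin d)) - 1) •
      (r ^ φ * Real.exp (-b * r ^ 2)) =
      ∫ r in Set.Ioi (0 : ℝ), r ^ ((d : ℝ) - 1 + φ) * Real.exp (-b * r ^ (2 : ℝ)) := by
    refine setIntegral_congr_fun measurableSet_Ioi fun r hr => ?_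
    have hr' : (0 : ℝ) < r := hr
    simp only [finrank_euclideanSpace, Fintype.card_fin, smul_eq_mul]
    rw [Real.rpow_add hr', ← mul_assoc, ← Real.rpow_natCast r (d - 1), Nat.cast_sub NeZero.one_le,
      Nat.cast_one, Real.rpow_two]
  have hG : Real.Gamma ((d : ℝ) / 2) ≠ 0 := (Real.Gamma_pos_of_pos (by positivity)).ne'
  rw [h1, integral_rpow_mul_exp_neg_mul_rpow two_pos (by linarith) hb, measureReal_def,
    EuclideanSpace.volume_ball]
  simp only [finrank_euclideanSpace, Fintype.card_fin, ENNReal.ofReal_one, one_pow, one_mul,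
    smul_eq_mul, nsmul_eq_mul]
  rw [ENNReal.toReal_ofReal
    (div_nonneg (by positivity) (Real.Gamma_pos_of_pos (by positivity)).le),
    Real.Gamma_add_one (by positivity), Real.sqrt_eq_rpow, ← Real.rpow_natCast,
    ← Real.rpow_mul Real.pi_pos.le,
    show (1 / 2 * d : ℝ) = (d : ℝ) / 2 by ring,
    show ((d : ℝ) - 1 + φ + 1) / 2 = (φ + d) / 2 by ring,
    show -((d : ℝ) - 1 + φ + 1) / 2 = -((φ + d) / 2) by ring]
  field_simp

theorem integrable_norm_rpow_mul_killedHeat [NeZero d] {φ t : ℝ} (hφ : 0 ≤ φ) (ht : 0 < t) :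
    Integrable fun y : EuclideanSpace ℝ (Fin d) => ‖y‖ ^ φ * killedHeat t y := by
  refine ((integrable_norm_rpow_mul_gaussian (d := d) hφ
    (show 0 < 1 / (2 * t) by positivity)).mul_const
    (1 / (2 * Real.pi * t) ^ ((d : ℝ) / 2) * Real.exp (-(1 / 2) * t))).congr (ae_of_all _ fun y => ?_)
  simp only [killedHeat]; ring

theorem integral_norm_rpow_mul_killedHeat [NeZero d] {φ t : ℝ} (hφ : 0 ≤ φ) (ht : 0 < t) :
    ∫ y : EuclideanSpace ℝ (Fin d), ‖y‖ ^ φ * killedHeat t y =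
      2 ^ (φ / 2) * Real.Gamma ((φ + d) / 2) / Real.Gamma ((d : ℝ) / 2) *
        (t ^ (φ / 2) * Real.exp (-(1 / 2) * t)) := by
  have h1 : ∀ y : EuclideanSpace ℝ (Fin d), ‖y‖ ^ φ * killedHeat t y =
      (‖y‖ ^ φ * Real.exp (-(1 / (2 * t)) * ‖y‖ ^ 2)) *
    (1 / (2 * Real.pi * t) ^ ((d : ℝ) / 2) * Real.exp (-(1 / 2) * t)) := fun y => by
    simp only [killedHeat]; ring
  simp_rw [h1]
  rw [integral_mul_const, integral_norm_rpow_mul_gaussian hφ (by positivity)]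
  have h2 : (1 / (2 * t)) ^ (-((φ + d) / 2)) =
      2 ^ (φ / 2) * t ^ (φ / 2) * (2 * t) ^ ((d : ℝ) / 2) := by
    rw [one_div, Real.inv_rpow (by positivity), Real.rpow_neg (by positivity), inv_inv,
      show (φ + d) / 2 = φ / 2 + (d : ℝ) / 2 by ring, Real.rpow_add (by positivity),
      Real.mul_rpow two_pos.le ht.le]
  have h3 : (2 * Real.pi * t) ^ ((d : ℝ) / 2) =
      Real.pi ^ ((d : ℝ) / 2) * (2 * t) ^ ((d : ℝ) / 2) := by
    rw [← Real.mul_rpow Real.pi_pos.le (by positivity)]; ring_nf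
  rw [h2, h3]
  have : Real.pi ^ ((d : ℝ) / 2) ≠ 0 := (Real.rpow_pos_of_pos Real.pi_pos _).ne'
  have : (2 * t) ^ ((d : ℝ) / 2) ≠ 0 := (Real.rpow_pos_of_pos (by positivity) _).ne'
  field_simp

/-- Integrating over space first leaves a multiple of `t^{φ/2} e^{-t/2}`, integrable on the
half-line. This licenses all later exchanges of space and time integrals, with no need for pointwise
estimates of `G_1` near its singularity. -/
theorem integrable_prod_norm_rpow_mul_killedHeat [NeZero d] {φ : ℝ} (hφ : 0 ≤ φ) :
    Integrable (fun p : EuclideanSpace ℝ (Fin d) × ℝ => ‖p.1‖ ^ φ * killedHeat p.2 p.1)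
      (volume.prod (volume.restrict (Set.Ioi 0))) := by
  have hmeas : AEStronglyMeasurable
      (fun p : EuclideanSpace ℝ (Fin d) × ℝ => ‖p.1‖ ^ φ * killedHeat p.2 p.1)
      (volume.prod (volume.restrict (Set.Ioi 0))) :=
    ((measurable_fst.norm.pow_const φ).mul measurable_killedHeat).aestronglyMeasurable
  refine (integrable_prod_iff' hmeas).2 ⟨?_, ?_⟩
  · filter_upwards [ae_restrict_mem measurableSet_Ioi] with t ht
    exact integrable_norm_rpow_mul_killedHeat hφ ht
  · have hi : IntegrableOn (fun t : ℝ =>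
        2 ^ (φ / 2) * Real.Gamma ((φ + d) / 2) / Real.Gamma ((d : ℝ) / 2) *
        (t ^ (φ / 2) * Real.exp (-(1 / 2) * t))) (Set.Ioi 0) := by
      have := integrableOn_rpow_mul_exp_neg_mul_rpow (p := 1) (s := φ / 2) (b := 1 / 2)
        (by linarith) one_pos (by norm_num)
      simp only [Real.rpow_one] at this
      exact this.const_mul _
    refine hi.congr_fun (fun t ht => ?_) measurableSet_Ioi
    beta_reduce
    rw [← integral_norm_rpow_mul_killedHeat hφ ht]
    refine integral_congr_ae (ae_of_all _ fun y => ?_)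
    simp only
    rw [Real.norm_of_nonneg]
    exact mul_nonneg (by positivity) (killedHeat_nonneg ht y)

theorem integrable_norm_rpow_mul_massiveGreen [NeZero d] {φ : ℝ} (hφ : 0 ≤ φ) :
    Integrable fun y : EuclideanSpace ℝ (Fin d) => ‖y‖ ^ φ * massiveGreen 1 y := by
  refine (integrable_prod_norm_rpow_mul_killedHeat hφ).integral_prod_left.congr
    (ae_of_all _ fun y => ?_)
  simp only [massiveGreen_one]
  rw [integral_const_mul]

theorem constA_eq [NeZero d] {φ : ℝ} (hφ : 0 ≤ φ) :
    constA d φ = (2 : ℝ) ^ (φ + 1) *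
        (Real.Gamma ((φ + 2) / 2) * Real.Gamma ((φ + d) / 2)) / Real.Gamma ((d : ℝ) / 2) := by
  have h1 : constA d φ = ∫ y : EuclideanSpace ℝ (Fin d), ∫ t in Set.Ioi (0 : ℝ),
      ‖y‖ ^ φ * killedHeat t y := by
    simp_rw [constA, massiveGreen_one, integral_const_mul]
  rw [h1, integral_integral_swap (f := fun y t => ‖y‖ ^ φ * killedHeat t y)
    (integrable_prod_norm_rpow_mul_killedHeat hφ),
    setIntegral_congr_fun measurableSet_Ioi
      (fun t ht => integral_norm_rpow_mul_killedHeat hφ ht), integral_const_mul]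
  have := integral_rpow_mul_exp_neg_mul_rpow (p := 1) (q := φ / 2) (b := 1 / 2)
        one_pos (by linarith) (by norm_num)
  simp only [Real.rpow_one] at this
  rw [this, show (φ / 2 + 1) / 1 = (φ + 2) / 2 by ring,
    show -(φ / 2 + 1) / 1 = -(φ / 2 + 1) by ring, one_div, Real.inv_rpow two_pos.le,
    Real.rpow_neg two_pos.le, inv_inv, show φ + 1 = φ / 2 + (φ / 2 + 1) by ring,
    Real.rpow_add two_pos (φ / 2) (φ / 2 + 1)]
  ring

theorem constA_pos [NeZero d] {φ : ℝ} (hφ : 0 ≤ φ) : 0 < constA d φ := by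
  have : (0 : ℝ) < d := by exact_mod_cast NeZero.pos d
  have h1 := Real.Gamma_pos_of_pos (show 0 < (φ + 2) / 2 by positivity)
  have h2 := Real.Gamma_pos_of_pos (show 0 < (φ + d) / 2 by positivity)
  have h3 := Real.Gamma_pos_of_pos (show 0 < (d : ℝ) / 2 by positivity)
  rw [constA_eq hφ]
  positivity

/-- This is the total mass of `G_1`, hence the factor `2` by which it is normalised to a probability
density. -/
theorem constA_zero [NeZero d] : constA d 0 = 2 := by
  have : (0 : ℝ) < d := by exact_mod_cast NeZero.pos d
  have h3 := Real.Gamma_pos_of_pos (show 0 < (d : ℝ) / 2 by positivity)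
  rw [constA_eq le_rfl]
  simp [Real.Gamma_one]
  field_simp

/-- The heat kernel at time `t` has transform `e^{-t|ξ|²/2}`, so with killing the time integral is
`∫ e^{-t(1+|ξ|²)/2} dt`. -/
theorem integral_massiveGreen_mul_cexp [NeZero d] (ξ : EuclideanSpace ℝ (Fin d)) :
    ∫ y : EuclideanSpace ℝ (Fin d),
      (massiveGreen 1 y : ℂ) * Complex.exp ((inner ℝ y ξ : ℝ) * Complex.I) =
      2 / (1 + (‖ξ‖ : ℂ) ^ 2) := by
  have h1 : ∀ y : EuclideanSpace ℝ (Fin d),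
      (massiveGreen 1 y : ℂ) * Complex.exp ((inner ℝ y ξ : ℝ) * Complex.I) =
      ∫ t in Set.Ioi (0 : ℝ), (killedHeat t y : ℂ) *
        Complex.exp ((inner ℝ y ξ : ℝ) * Complex.I) := fun y => by
    rw [integral_mul_const, massiveGreen_one, integral_complex_ofReal]
  simp_rw [h1]
  rw [integral_integral_swap (f := fun y t => (killedHeat t y : ℂ) *
        Complex.exp ((inner ℝ y ξ : ℝ) * Complex.I))]
  · have h2 : ∀ t ∈ Set.Ioi (0 : ℝ), ∫ y : EuclideanSpace ℝ (Fin d), (killedHeat t y : ℂ) *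
        Complex.exp ((inner ℝ y ξ : ℝ) * Complex.I) =
        ((Real.exp (-((1 + ‖ξ‖ ^ 2) / 2) * t) : ℝ) : ℂ) := fun t ht => by
      have ht' : (0 : ℝ) < t := ht
      have hG := GaussianFourier.integral_cexp_neg_mul_sq_norm_add
        (V := EuclideanSpace ℝ (Fin d)) (b := ((1 / (2 * t) : ℝ) : ℂ))
        (by rw [Complex.ofReal_re]; positivity) Complex.I ξ
      have h3 : ∀ y : EuclideanSpace ℝ (Fin d), (killedHeat t y : ℂ) *
        Complex.exp ((inner ℝ y ξ : ℝ) * Complex.I) =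
          ((1 / (2 * Real.pi * t) ^ ((d : ℝ) / 2) * Real.exp (-(1 / 2) * t) : ℝ) : ℂ) *
          Complex.exp (-((1 / (2 * t) : ℝ) : ℂ) * (‖y‖ : ℂ) ^ 2 +
            Complex.I * (inner ℝ ξ y : ℝ)) := fun y => by
        rw [Complex.exp_add, real_inner_comm ξ y, killedHeat, mul_comm Complex.I]
        push_cast
        ring
      simp_rw [h3]
      rw [integral_const_mul, hG]
      have h4 : ((Real.pi : ℂ) / ((1 / (2 * t) : ℝ) : ℂ)) ^
          (Module.finrank ℝ (EuclideanSpace ℝ (Fin d)) / 2 : ℂ) =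
          (((2 * Real.pi * t) ^ ((d : ℝ) / 2) : ℝ) : ℂ) := by
        rw [Complex.ofReal_cpow (by positivity)]
        simp only [finrank_euclideanSpace, Fintype.card_fin]
        push_cast
        congr 1
        field_simp
      have h5 : Complex.exp (Complex.I ^ 2 * (‖ξ‖ : ℂ) ^ 2 / (4 * ((1 / (2 * t) : ℝ) : ℂ))) =
          ((Real.exp (-(‖ξ‖ ^ 2 / 2) * t) : ℝ) : ℂ) := by
        rw [Complex.ofReal_exp]
        congr 1
        have : (t : ℂ) ≠ 0 := by exact_mod_cast ht'.ne'
        push_cast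
        rw [Complex.I_sq]
        field_simp
        ring
      rw [h4, h5, ← Complex.ofReal_mul, ← Complex.ofReal_mul]
      congr 1
      have : (2 * Real.pi * t) ^ ((d : ℝ) / 2) ≠ 0 :=
        (Real.rpow_pos_of_pos (by positivity) _).ne'
      rw [show -((1 + ‖ξ‖ ^ 2) / 2) * t = -(1 / 2) * t + -(‖ξ‖ ^ 2 / 2) * t by ring, Real.exp_add]
      field_simp
    rw [setIntegral_congr_fun measurableSet_Ioi h2, integral_complex_ofReal,
      integral_exp_mul_Ioi (by nlinarith [sq_nonneg ‖ξ‖])]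
    have : (1 + (‖ξ‖ : ℂ) ^ 2) ≠ 0 := by
      norm_cast; positivity
    push_cast
    simp
  -- The phase has modulus one, so the case `φ = 0` dominates and justifies Fubini.
  · have h0 := integrable_prod_norm_rpow_mul_killedHeat (d := d) le_rfl
    simp only [Real.rpow_zero, one_mul] at h0
    refine Integrable.mono h0 ?_ (ae_of_all _ fun p => ?_)
    · refine Measurable.aestronglyMeasurable ?_
      refine (Complex.measurable_ofReal.comp measurable_killedHeat).mul ?_
      fun_prop
    · simp only [Function.uncurry]
      rw [norm_mul, Complex.norm_exp_ofReal_mul_I, mul_one, Complex.norm_real]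

/-- The probability measure on `ℝ^d` with density `massiveGreen 1 / 2`. -/
noncomputable def greenLaw (d : ℕ) : Measure (EuclideanSpace ℝ (Fin d)) :=
  volume.withDensity fun y => ENNReal.ofReal (massiveGreen 1 y / 2)

theorem integrable_massiveGreen [NeZero d] :
    Integrable fun y : EuclideanSpace ℝ (Fin d) => massiveGreen 1 y := by
  simpa using integrable_norm_rpow_mul_massiveGreen (d := d) le_rfl

theorem integral_greenLaw [NeZero d] {F : Type*} [NormedAddCommGroup F] [NormedSpace ℝ F]
    (f : EuclideanSpace ℝ (Fin d) → F) :
    ∫ y, f y ∂greenLaw d = ∫ y, (massiveGreen 1 y / 2) • f y := by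
  rw [greenLaw, integral_withDensity_eq_integral_toReal_smul₀
    (integrable_massiveGreen.div_const 2).aestronglyMeasurable.aemeasurable.ennreal_ofReal
    (ae_of_all _ fun y => ENNReal.ofReal_lt_top)]
  refine integral_congr_ae (ae_of_all _ fun y => ?_)
  simp only
  rw [ENNReal.toReal_ofReal (div_nonneg (massiveGreen_one_nonneg y) two_pos.le)]

theorem integrable_norm_rpow_greenLaw [NeZero d] {φ : ℝ} (hφ : 0 ≤ φ) :
    Integrable (fun y : EuclideanSpace ℝ (Fin d) => ‖y‖ ^ φ) (greenLaw d) := by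
  rw [greenLaw, integrable_withDensity_iff_integrable_smul₀'
    (integrable_massiveGreen.div_const 2).aestronglyMeasurable.aemeasurable.ennreal_ofReal
    (ae_of_all _ fun y => ENNReal.ofReal_lt_top)]
  refine ((integrable_norm_rpow_mul_massiveGreen (d := d) hφ).div_const 2).congr
    (ae_of_all _ fun y => ?_)
  simp only
  rw [ENNReal.toReal_ofReal (div_nonneg (massiveGreen_one_nonneg y) two_pos.le), smul_eq_mul]
  ring

theorem integral_norm_rpow_greenLaw [NeZero d] (φ : ℝ) :
    ∫ y : EuclideanSpace ℝ (Fin d), ‖y‖ ^ φ ∂greenLaw d = constA d φ / 2 := by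
  rw [integral_greenLaw, constA, ← integral_div]
  refine integral_congr_ae (ae_of_all _ fun y => ?_)
  simp only [smul_eq_mul]; ring

instance isProbabilityMeasure_greenLaw [NeZero d] : IsProbabilityMeasure (greenLaw d) := by
  refine ⟨?_⟩
  have h : ∫ y : EuclideanSpace ℝ (Fin d), massiveGreen 1 y / 2 = 1 := by
    have := constA_zero (d := d)
    simp only [constA, Real.rpow_zero, one_mul] at this
    rw [integral_div, this]; norm_num
  rw [greenLaw, withDensity_apply _ MeasurableSet.univ, Measure.restrict_univ,
    ← ofReal_integral_eq_lintegral_ofReal (integrable_massiveGreen.div_const 2)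
      (ae_of_all _ fun y => div_nonneg (massiveGreen_one_nonneg y) two_pos.le), h,
    ENNReal.ofReal_one]

theorem charFun_greenLaw [NeZero d] (ξ : EuclideanSpace ℝ (Fin d)) :
    charFun (greenLaw d) ξ = 1 / (1 + (‖ξ‖ : ℂ) ^ 2) := by
  rw [charFun_apply, integral_greenLaw]
  have h : ∀ y : EuclideanSpace ℝ (Fin d), (massiveGreen 1 y / 2) •
      Complex.exp ((inner ℝ y ξ : ℝ) * Complex.I) =
      ((massiveGreen 1 y : ℂ) * Complex.exp ((inner ℝ y ξ : ℝ) * Complex.I)) / 2 := fun y => by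
    rw [Complex.real_smul]; push_cast; ring
  simp_rw [h]
  rw [integral_div, integral_massiveGreen_mul_cexp]
  ring

/-! ### Weak convergence tested against unbounded functions. -/

section Truncation

variable {E : Type*} [TopologicalSpace E] [MeasurableSpace E] [OpensMeasurableSpace E]

theorem integrable_of_integrable_sq {μ : Measure E} [IsProbabilityMeasure μ] {f : E → ℝ}
    (hf : Continuous f) (hint : Integrable (fun x => f x ^ 2) μ) : Integrable f μ := by
  refine Integrable.mono' ((integrable_const (1 : ℝ)).add hint) hf.measurable.aestronglyMeasurable
    (ae_of_all _ fun x => ?_)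
  simp only [Pi.add_apply]
  rw [Real.norm_eq_abs]
  nlinarith [sq_nonneg (|f x| - 1), sq_abs (f x), sq_nonneg (f x)]

/-- The excess `f - min f R` vanishes where `f ≤ R` and is at most `f ≤ f² / R` elsewhere. -/
theorem abs_integral_sub_integral_min_le {μ : Measure E} [IsProbabilityMeasure μ] {f : E → ℝ}
    (hf : Continuous f) (hint : Integrable (fun x => f x ^ 2) μ) {R : ℝ} (hR : 0 < R) :
    |∫ x, f x ∂μ - ∫ x, min (f x) R ∂μ| ≤ (∫ x, f x ^ 2 ∂μ) / R := by
  have h1 := integrable_of_integrable_sq hf hint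
  have h2 : Integrable (fun x => min (f x) R) μ := h1.inf (integrable_const R)
  rw [← integral_sub h1 h2, ← integral_div, abs_of_nonneg
    (integral_nonneg fun x => sub_nonneg.2 (min_le_left _ _))]
  refine integral_mono (h1.sub h2) (hint.div_const R) fun x => ?_
  simp only
  rw [le_div_iff₀ hR]
  rcases le_total (f x) R with h | h
  · rw [min_eq_left h]; nlinarith [sq_nonneg (f x)]
  · rw [min_eq_right h]; nlinarith [sq_nonneg (f x)]

/-- Weak convergence together with bounded second moments of a nonnegative continuous function
gives convergence of its integrals. -/
theorem tendsto_integral_of_tendsto_of_sq_bounded {ι : Type*} {l : Filter ι}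
    {P : ι → ProbabilityMeasure E} {Q : ProbabilityMeasure E} (h : Tendsto P l (𝓝 Q))
    {f : E → ℝ} (hf : Continuous f) (h0 : ∀ x, 0 ≤ f x) {C : ℝ}
    (hC : ∀ᶠ i in l, Integrable (fun x => f x ^ 2) (P i : Measure E) ∧
      ∫ x, f x ^ 2 ∂(P i : Measure E) ≤ C)
    (hQ : Integrable (fun x => f x ^ 2) (Q : Measure E)) :
    Tendsto (fun i => ∫ x, f x ∂(P i : Measure E)) l (𝓝 (∫ x, f x ∂(Q : Measure E))) := by
  rw [Metric.tendsto_nhds]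
  intro ε hε
  set C' : ℝ := |C| + ∫ x, f x ^ 2 ∂(Q : Measure E) with hC'
  have hQ0 : 0 ≤ ∫ x, f x ^ 2 ∂(Q : Measure E) := integral_nonneg fun x => sq_nonneg _
  have hC'0 : 0 ≤ C' := add_nonneg (abs_nonneg _) hQ0
  -- `C'` bounds the second moments of the limit and, eventually, of the approximants, so one
  -- truncation level costs less than `ε/3` on each side. The last third goes to weak convergence
  -- tested on the truncated function.
  obtain ⟨R, hR, hRε⟩ : ∃ R : ℝ, 0 < R ∧ C' / R < ε / 3 := by
    refine ⟨3 * (C' + 1) / ε, by positivity, ?_⟩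
    rw [div_div_eq_mul_div, div_lt_iff₀ (by positivity)]
    have : ε / 3 * (3 * (C' + 1)) = (C' + 1) * ε := by ring
    nlinarith
  let g : BoundedContinuousFunction E ℝ := BoundedContinuousFunction.mkOfBound
    ⟨fun x => min (f x) R, hf.min continuous_const⟩ (2 * R) (fun x y => by
      simp only [ContinuousMap.coe_mk]
      have hx : |min (f x) R| ≤ R := by
        rw [abs_of_nonneg (le_min (h0 x) hR.le)]; exact min_le_right _ _
      have hy : |min (f y) R| ≤ R := by
        rw [abs_of_nonneg (le_min (h0 y) hR.le)]; exact min_le_right _ _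
      rw [Real.dist_eq]
      exact (abs_sub _ _).trans (by linarith))
  have hg := (ProbabilityMeasure.tendsto_iff_forall_integral_tendsto.1 h) g
  have hg' := (Metric.tendsto_nhds.1 hg) (ε / 3) (by positivity)
  filter_upwards [hC, hg'] with i hi hgi
  have e1 := abs_integral_sub_integral_min_le hf hi.1 hR
  have e2 := abs_integral_sub_integral_min_le hf hQ hR
  have e3 : (∫ x, f x ^ 2 ∂(P i : Measure E)) / R ≤ C' / R := by
    gcongr
    exact hi.2.trans ((le_abs_self C).trans (by linarith))
  have e4 : (∫ x, f x ^ 2 ∂(Q : Measure E)) / R ≤ C' / R := by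
    gcongr
    linarith [abs_nonneg C]
  rw [Real.dist_eq] at hgi ⊢
  change |∫ x, min (f x) R ∂(P i : Measure E) - ∫ x, min (f x) R ∂(Q : Measure E)| < ε / 3 at hgi
  rw [abs_lt] at hgi ⊢
  rw [abs_le] at e1 e2
  constructor <;> linarith [e1.1, e1.2, e2.1, e2.2, hgi.1, hgi.2]

end Truncation

/-! ### Rescaled lattice laws and convergence of their moments. -/

/-- The measure `∑_x p(x) δ_{m x}` on `ℝ^d`. -/
noncomputable def latticeLaw (p : (Fin d → ℤ) → ℝ) (m : ℝ) : Measure (EuclideanSpace ℝ (Fin d)) :=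
  (Measure.count.withDensity fun x => ENNReal.ofReal (p x)).map fun x => m • toE x

theorem measurable_smul_toE (m : ℝ) : Measurable fun x : Fin d → ℤ => m • toE x :=
  measurable_of_countable _

theorem isProbabilityMeasure_latticeLaw {p : (Fin d → ℤ) → ℝ} (h0 : ∀ x, 0 ≤ p x)
    (h1 : HasSum p 1) (m : ℝ) : IsProbabilityMeasure (latticeLaw p m) := by
  refine ⟨?_⟩
  rw [latticeLaw, Measure.map_apply (measurable_smul_toE m) MeasurableSet.univ, Set.preimage_univ,
    withDensity_apply _ MeasurableSet.univ, Measure.restrict_univ, lintegral_count,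
    ← ENNReal.ofReal_tsum_of_nonneg h0 h1.summable, h1.tsum_eq, ENNReal.ofReal_one]

theorem integrable_latticeLaw {F : Type*} [NormedAddCommGroup F] [NormedSpace ℝ F]
    {p : (Fin d → ℤ) → ℝ} (h0 : ∀ x, 0 ≤ p x) (m : ℝ) {f : EuclideanSpace ℝ (Fin d) → F}
    (hf : StronglyMeasurable f) (hs : Summable fun x => p x * ‖f (m • toE x)‖) :
    Integrable f (latticeLaw p m) := by
  rw [latticeLaw, integrable_map_measure hf.aestronglyMeasurable
    (measurable_smul_toE m).aemeasurable, integrable_withDensity_iff_integrable_smul₀'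
    (measurable_of_countable _).aemeasurable (ae_of_all _ fun y => ENNReal.ofReal_lt_top),
    integrable_count_iff]
  refine hs.congr fun x => ?_
  rw [norm_smul, ENNReal.toReal_ofReal (h0 x), Real.norm_of_nonneg (h0 x), Function.comp_apply]

theorem integral_latticeLaw {F : Type*} [NormedAddCommGroup F] [NormedSpace ℝ F] [CompleteSpace F]
    {p : (Fin d → ℤ) → ℝ} (h0 : ∀ x, 0 ≤ p x) (m : ℝ) {f : EuclideanSpace ℝ (Fin d) → F}
    (hf : StronglyMeasurable f) (hs : Summable fun x => p x * ‖f (m • toE x)‖) :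
    ∫ y, f y ∂latticeLaw p m = ∑' x, p x • f (m • toE x) := by
  rw [latticeLaw, integral_map (measurable_smul_toE m).aemeasurable hf.aestronglyMeasurable,
    integral_withDensity_eq_integral_toReal_smul₀
    (measurable_of_countable _).aemeasurable (ae_of_all _ fun y => ENNReal.ofReal_lt_top),
    integral_countable]
  · refine tsum_congr fun x => ?_
    rw [measureReal_def, Measure.count_singleton, ENNReal.toReal_one, one_smul,
      ENNReal.toReal_ofReal (h0 x)]
  · rw [integrable_count_iff]
    refine hs.congr fun x => ?_
    rw [norm_smul, ENNReal.toReal_ofReal (h0 x), Real.norm_of_nonneg (h0 x)]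

/-- If rescaled lattice laws have convergent characteristic functions, and a nonnegative
continuous function has bounded second moments, then its expectations converge. -/
theorem tendsto_tsum_of_tendsto_charFun {ι : Type*} {l : Filter ι} [l.IsCountablyGenerated]
    {p : ι → (Fin d → ℤ) → ℝ} {m : ι → ℝ} {Q : ProbabilityMeasure (EuclideanSpace ℝ (Fin d))}
    (hp : ∀ᶠ i in l, (∀ x, 0 ≤ p i x) ∧ HasSum (p i) 1)
    (hchar : ∀ ξ : EuclideanSpace ℝ (Fin d), Tendsto (fun i => ∑' x : Fin d → ℤ,
      p i x • Complex.exp ((inner ℝ (m i • toE x) ξ : ℝ) * Complex.I)) l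
        (𝓝 (charFun (Q : Measure (EuclideanSpace ℝ (Fin d))) ξ)))
    {f : EuclideanSpace ℝ (Fin d) → ℝ} (hf : Continuous f) (h0 : ∀ x, 0 ≤ f x) {C : ℝ}
    (hC : ∀ᶠ i in l, Summable (fun x => p i x * f (m i • toE x) ^ 2) ∧
      ∑' x, p i x * f (m i • toE x) ^ 2 ≤ C)
    (hQ : Integrable (fun x => f x ^ 2) (Q : Measure (EuclideanSpace ℝ (Fin d)))) :
    Tendsto (fun i => ∑' x, p i x * f (m i • toE x)) l
      (𝓝 (∫ x, f x ∂(Q : Measure (EuclideanSpace ℝ (Fin d))))) := by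
  classical
  refine tendsto_of_seq_tendsto fun u hu => ?_
  -- The weights are probabilities only eventually; the value `Q` elsewhere is a filler that does
  -- not affect the limit.
  let P : ℕ → ProbabilityMeasure (EuclideanSpace ℝ (Fin d)) := fun n =>
    if h : (∀ x, 0 ≤ p (u n) x) ∧ HasSum (p (u n)) 1 then
      ⟨latticeLaw (p (u n)) (m (u n)), isProbabilityMeasure_latticeLaw h.1 h.2 _⟩ else Q
  have hP : ∀ᶠ n in atTop, ((∀ x, 0 ≤ p (u n) x) ∧ HasSum (p (u n)) 1) ∧
      (P n : Measure (EuclideanSpace ℝ (Fin d))) = latticeLaw (p (u n)) (m (u n)) := by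
    filter_upwards [hu.eventually hp] with n hn
    have h : P n = ⟨latticeLaw (p (u n)) (m (u n)), isProbabilityMeasure_latticeLaw hn.1 hn.2 _⟩ :=
      dif_pos hn
    exact ⟨hn, by rw [h]; rfl⟩
  have hsq : StronglyMeasurable fun x => f x ^ 2 := (hf.pow 2).stronglyMeasurable
  have hweak : Tendsto P atTop (𝓝 Q) := by
    refine ProbabilityMeasure.tendsto_of_tendsto_charFun fun ξ => ?_
    refine ((hchar ξ).comp hu).congr' ?_
    filter_upwards [hP] with n hn
    rw [hn.2, charFun_apply, integral_latticeLaw hn.1.1]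
    · rfl
    · exact Continuous.stronglyMeasurable (by fun_prop)
    · simpa [Complex.norm_exp_ofReal_mul_I] using hn.1.2.summable
  have hlim := tendsto_integral_of_tendsto_of_sq_bounded hweak hf h0 (C := C) ?_ hQ
  · refine hlim.congr' ?_
    filter_upwards [hP, hu.eventually hC] with n hn hCn
    rw [hn.2, integral_latticeLaw hn.1.1 _ hf.stronglyMeasurable]
    · rfl
    · refine Summable.of_nonneg_of_le (fun x => mul_nonneg (hn.1.1 x) (norm_nonneg _)) (fun x => ?_)
        (hn.1.2.summable.add hCn.1)
      rw [Real.norm_of_nonneg (h0 _)]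
      nlinarith [hn.1.1 x, mul_nonneg (hn.1.1 x) (sq_nonneg (f (m (u n) • toE x) - 1)),
        mul_nonneg (hn.1.1 x) (sq_nonneg (f (m (u n) • toE x)))]
  · filter_upwards [hP, hu.eventually hC] with n hn hCn
    have hs : Summable fun x => p (u n) x * ‖f (m (u n) • toE x) ^ 2‖ := by
      refine hCn.1.congr fun x => ?_
      rw [Real.norm_of_nonneg (sq_nonneg _)]
    rw [hn.2]
    refine ⟨integrable_latticeLaw hn.1.1 _ hsq hs, ?_⟩
    rw [integral_latticeLaw hn.1.1 _ hsq hs]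
    exact hCn.2

/-! ### Weighted norms and exponential tilts -/

theorem summable_of_weightedNorm_le {a M : ℝ} {f : (Fin d → ℤ) → ℝ} (hM : 0 ≤ M)
    (h : weightedNorm a 1 f ≤ ENNReal.ofReal M) :
    Summable (fun x => ‖toE x‖ ^ a * |f x|) ∧ ∑' x, ‖toE x‖ ^ a * |f x| ≤ M := by
  have h0 : ∀ x, 0 ≤ ‖toE x‖ ^ a * |f x| := fun x => by positivity
  have h1 : weightedNorm a 1 f = ∑' x, ENNReal.ofReal (‖toE x‖ ^ a * |f x|) := by
    rw [weightedNorm, ENNReal.ofReal_one, eLpNorm_one_eq_lintegral_enorm, lintegral_count]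
    refine tsum_congr fun x => ?_
    rw [← ofReal_norm, norm_mul, Real.norm_of_nonneg (by positivity), Real.norm_eq_abs]
  rw [h1] at h
  have hs : Summable fun x => ‖toE x‖ ^ a * |f x| := by
    have := ENNReal.summable_toReal (h.trans_lt ENNReal.ofReal_lt_top).ne
    refine this.congr fun x => ?_
    rw [ENNReal.toReal_ofReal (h0 x)]
  refine ⟨hs, ?_⟩
  rw [← ENNReal.ofReal_tsum_of_nonneg h0 hs] at h
  exact (ENNReal.ofReal_le_ofReal_iff hM).1 h

theorem inner_e1_toE [NeZero d] (t : ℝ) (x : Fin d → ℤ) :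
    inner ℝ (e1 t) (toE x) = t * (x 0 : ℝ) := by
  rw [e1, EuclideanSpace.inner_single_left]
  simp [toE]

theorem tilt_e1 [NeZero d] (f : (Fin d → ℤ) → ℝ) (t : ℝ) (x : Fin d → ℤ) :
    tilt f (e1 t) x = f x * Real.exp (t * x 0) := by
  rw [tilt, inner_e1_toE]

theorem e1_zero [NeZero d] : (e1 0 : EuclideanSpace ℝ (Fin d)) = 0 := by
  simp [e1]

theorem continuous_e1 [NeZero d] : Continuous (e1 : ℝ → EuclideanSpace ℝ (Fin d)) := by
  have : (e1 : ℝ → EuclideanSpace ℝ (Fin d)) = fun t => t • EuclideanSpace.single 0 1 := by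
    funext t
    ext i
    by_cases h : i = 0 <;> simp [e1, h]
  rw [this]
  fun_prop

theorem norm_e1 [NeZero d] (t : ℝ) : ‖(e1 t : EuclideanSpace ℝ (Fin d))‖ = |t| := by
  simp [e1]

/-! ### Convolution equations -/

/-- The shear `(x, y) ↦ (x - y, y)`. -/
def shearEquiv (G : Type*) [AddCommGroup G] : G × G ≃ G × G where
  toFun p := (p.1 - p.2, p.2)
  invFun p := (p.1 + p.2, p.2)
  left_inv p := by simp
  right_inv p := by simp

theorem tsum_mul_tsum_shear {G 𝕜 : Type*} [AddCommGroup G] [RCLike 𝕜] {f g : G → 𝕜}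
    (hf : Summable fun x => ‖f x‖) (hg : Summable fun x => ‖g x‖) :
    (∑' x, f x) * ∑' x, g x = ∑' x, ∑' y, f (x - y) * g y := by
  have hprod : Summable fun p : G × G => f p.1 * g p.2 := summable_mul_of_summable_norm hf hg
  have hprod' : Summable ((fun p : G × G => f p.1 * g p.2) ∘ shearEquiv G) :=
    (shearEquiv G).summable_iff.2 hprod
  rw [tsum_mul_tsum_of_summable_norm hf hg, ← (shearEquiv G).tsum_eq]
  exact hprod'.tsum_prod

/-- A multiplicative character turns the convolution equation `S = h + J * S` into a
product identity. -/
theorem tsum_mul_one_sub_of_convolution {G 𝕜 : Type*} [AddCommGroup G] [RCLike 𝕜] {S J h : G → ℝ}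
    (hconv : ∀ x, S x = h x + ∑' y, J (x - y) * S y)
    {e : G → 𝕜} (he : ∀ x y, e (x + y) = e x * e y)
    (hS : Summable fun x => |S x| * ‖e x‖) (hJ : Summable fun x => |J x| * ‖e x‖)
    (hh : Summable fun x => |h x| * ‖e x‖) :
    (∑' x, (S x : 𝕜) * e x) * (1 - ∑' x, (J x : 𝕜) * e x) = ∑' x, (h x : 𝕜) * e x := by
  have norm_eq : ∀ f : G → ℝ, ∀ x, ‖(f x : 𝕜) * e x‖ = |f x| * ‖e x‖ := fun f x => by
    rw [norm_mul, RCLike.norm_ofReal]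
  have hS' : Summable fun x => ‖(S x : 𝕜) * e x‖ := hS.congr fun x => (norm_eq S x).symm
  have hJ' : Summable fun x => ‖(J x : 𝕜) * e x‖ := hJ.congr fun x => (norm_eq J x).symm
  have hh' : Summable fun x => ‖(h x : 𝕜) * e x‖ := hh.congr fun x => (norm_eq h x).symm
  have hterm : ∀ x, (S x : 𝕜) * e x - (h x : 𝕜) * e x =
      ∑' y, ((J (x - y) : 𝕜) * e (x - y)) * ((S y : 𝕜) * e y) := fun x => by
    rw [← sub_mul, ← RCLike.ofReal_sub, hconv x, add_sub_cancel_left, RCLike.ofReal_tsum,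
      ← tsum_mul_right]
    refine tsum_congr fun y => ?_
    have : e x = e (x - y) * e y := by rw [← he, sub_add_cancel]
    rw [this]
    push_cast
    ring
  have key := tsum_mul_tsum_shear hJ' hS'
  rw [← tsum_congr hterm, hS'.of_norm.tsum_sub hh'.of_norm] at key
  rw [mul_sub, mul_one, mul_comm (∑' x, (S x : 𝕜) * e x) (∑' x, (J x : 𝕜) * e x), key]
  ring

/-! ### Lattice symmetry -/

/-- The sign change of coordinate `i`. -/
def flipEquiv (i : Fin d) : (Fin d → ℤ) ≃ (Fin d → ℤ) where
  toFun x := Function.update x i (-x i)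
  invFun x := Function.update x i (-x i)
  left_inv x := by simp
  right_inv x := by simp

theorem flipEquiv_apply (i : Fin d) (x : Fin d → ℤ) :
    flipEquiv i x = Function.update x i (-x i) := rfl

/-- The coordinate permutation `x ↦ x ∘ π`. -/
def permEquiv (π : Equiv.Perm (Fin d)) : (Fin d → ℤ) ≃ (Fin d → ℤ) where
  toFun x := x ∘ π
  invFun x := x ∘ π.symm
  left_inv x := by ext; simp
  right_inv x := by ext; simp

theorem LatticeSymmetric.comp_neg {f : (Fin d → ℤ) → ℝ} (hf : LatticeSymmetric f)
    (x : Fin d → ℤ) : f (-x) = f x := by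
  classical
  -- The coordinates are negated one at a time.
  have key : ∀ s : Finset (Fin d), f (fun i => if i ∈ s then -x i else x i) = f x := by
    intro s
    induction s using Finset.induction_on with
    | empty => simp
    | insert a s ha ih =>
      rw [← ih, ← hf.1 (fun i => if i ∈ s then -x i else x i) a]
      congr 1
      funext i
      by_cases hi : i = a
      · subst hi; simp [ha]
      · simp [hi, Function.update_of_ne]
  simpa [Pi.neg_def] using key Finset.univ

theorem norm_toE_sq (x : Fin d → ℤ) : ‖toE x‖ ^ 2 = ∑ i, (x i : ℝ) ^ 2 := by
  rw [EuclideanSpace.norm_sq_eq]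
  simp [toE]

theorem norm_toE_congr {x y : Fin d → ℤ} (h : ∑ i, (x i : ℝ) ^ 2 = ∑ i, (y i : ℝ) ^ 2) :
    ‖toE x‖ = ‖toE y‖ := by
  rw [← norm_toE_sq, ← norm_toE_sq] at h
  exact (sq_eq_sq₀ (norm_nonneg _) (norm_nonneg _)).1 h

/-- Radial weights preserve symmetry, so the weighted function `|x|^{2+ζ} |f(x)|` can also be
symmetrised under `x_1 ↦ -x_1`. -/
theorem latticeSymmetric_comp_norm (F : ℝ → ℝ) :
    LatticeSymmetric fun x : Fin d → ℤ => F ‖toE x‖ := by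
  refine ⟨fun x i => congrArg F (norm_toE_congr (Finset.sum_congr rfl fun j _ => ?_)),
    fun x π => congrArg F (norm_toE_congr ?_)⟩
  · by_cases h : j = i
    · subst h; simp
    · simp [Function.update_of_ne h]
  · exact Equiv.sum_comp π fun i => (x i : ℝ) ^ 2

theorem LatticeSymmetric.mul {f g : (Fin d → ℤ) → ℝ} (hf : LatticeSymmetric f)
    (hg : LatticeSymmetric g) : LatticeSymmetric fun x => f x * g x :=
  ⟨fun x i => by simp only [hf.1, hg.1], fun x π => by simp only [hf.2, hg.2]⟩

theorem LatticeSymmetric.abs {f : (Fin d → ℤ) → ℝ} (hf : LatticeSymmetric f) :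
    LatticeSymmetric fun x => |f x| :=
  ⟨fun x i => by simp only [hf.1], fun x π => by simp only [hf.2]⟩

section Coordinates

variable {f : (Fin d → ℤ) → ℝ}

theorem LatticeSymmetric.swap_coord (hf : LatticeSymmetric f) (F : ℤ → ℝ) (i j : Fin d) :
    (fun x => f x * F (x i)) ∘ permEquiv (Equiv.swap i j) = fun x => f x * F (x j) := by
  funext x
  simp [permEquiv, hf.2]

theorem LatticeSymmetric.summable_coord (hf : LatticeSymmetric f) (F : ℤ → ℝ) (i j : Fin d)
    (h : Summable fun x => f x * F (x i)) : Summable fun x => f x * F (x j) := by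
  rw [← hf.swap_coord F i j, (permEquiv (Equiv.swap i j)).summable_iff]
  exact h

theorem LatticeSymmetric.tsum_coord (hf : LatticeSymmetric f) (F : ℤ → ℝ) (i j : Fin d) :
    ∑' x, f x * F (x j) = ∑' x, f x * F (x i) := by
  rw [← hf.swap_coord F i j]
  exact (permEquiv (Equiv.swap i j)).tsum_eq fun x => f x * F (x i)

theorem LatticeSymmetric.flip_coord (hf : LatticeSymmetric f) (F : ℤ → ℝ) (i : Fin d) :
    (fun x => f x * F (x i)) ∘ flipEquiv i = fun x => f x * F (-x i) := by
  funext x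
  simp [flipEquiv_apply, hf.1]

theorem LatticeSymmetric.summable_neg_coord (hf : LatticeSymmetric f) (F : ℤ → ℝ) (i : Fin d)
    (h : Summable fun x => f x * F (x i)) : Summable fun x => f x * F (-x i) := by
  rw [← hf.flip_coord F i, (flipEquiv i).summable_iff]
  exact h

theorem LatticeSymmetric.tsum_neg_coord (hf : LatticeSymmetric f) (F : ℤ → ℝ) (i : Fin d) :
    ∑' x, f x * F (-x i) = ∑' x, f x * F (x i) := by
  rw [← hf.flip_coord F i]
  exact (flipEquiv i).tsum_eq fun x => f x * F (x i)

/-- Flipping the sign of coordinate `i` turns the sum into its negative. -/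
theorem LatticeSymmetric.tsum_mul_coord_mul_coord (hf : LatticeSymmetric f) {i j : Fin d} (hij : i ≠ j) :
    ∑' x, f x * ((x i : ℝ) * x j) = 0 := by
  have h := (flipEquiv i).tsum_eq fun x => f x * ((x i : ℝ) * x j)
  have h' : ∀ x, f (flipEquiv i x) * ((flipEquiv i x i : ℝ) * flipEquiv i x j) =
      -(f x * ((x i : ℝ) * x j)) := fun x => by
    rw [flipEquiv_apply, hf.1, Function.update_self, Function.update_of_ne hij.symm]
    push_cast
    ring
  simp_rw [h', tsum_neg] at h
  linarith

end Coordinates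

theorem abs_coord_le_norm (x : Fin d → ℤ) (i : Fin d) : |(x i : ℝ)| ≤ ‖toE x‖ := by
  simpa [toE] using PiLp.norm_apply_le (toE x) i

theorem one_le_norm_toE {x : Fin d → ℤ} (hx : ‖toE x‖ ≠ 0) : 1 ≤ ‖toE x‖ := by
  have : ∃ i, x i ≠ 0 := by
    by_contra! h
    refine hx ?_
    have := norm_toE_sq x
    simp only [h, Int.cast_zero, ne_eq, OfNat.ofNat_ne_zero, not_false_eq_true, zero_pow,
      Finset.sum_const_zero] at this
    exact pow_eq_zero_iff two_ne_zero |>.1 this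
  obtain ⟨i, hi⟩ := this
  refine le_trans ?_ (abs_coord_le_norm x i)
  exact_mod_cast Int.one_le_abs hi

/-- Nonzero lattice points have norm at least one. Positivity of `a` is needed at the origin, where
`0 ^ 0 = 1`. -/
theorem norm_toE_rpow_le_rpow {a b : ℝ} (ha : 0 < a) (hab : a ≤ b) (x : Fin d → ℤ) :
    ‖toE x‖ ^ a ≤ ‖toE x‖ ^ b := by
  by_cases hx : ‖toE x‖ = 0
  · rw [hx, Real.zero_rpow ha.ne', Real.zero_rpow (by linarith)]
  · exact Real.rpow_le_rpow_of_exponent_le (one_le_norm_toE hx) hab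

theorem LatticeSymmetric.tsum_mul_coord_sq {f : (Fin d → ℤ) → ℝ} (hf : LatticeSymmetric f)
    (hs : Summable fun x => ‖toE x‖ ^ 2 * |f x|) (i : Fin d) :
    ∑' x, f x * (x i : ℝ) ^ 2 = (∑' x, ‖toE x‖ ^ 2 * f x) / d := by
  have hd : (d : ℝ) ≠ 0 := by exact_mod_cast (Fin.pos i).ne'
  have hsi : ∀ j, Summable fun x => f x * (x j : ℝ) ^ 2 := fun j => by
    refine Summable.of_norm_bounded hs fun x => ?_
    rw [norm_mul, Real.norm_eq_abs, Real.norm_of_nonneg (sq_nonneg _), mul_comm, ← sq_abs (x j : ℝ)]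
    gcongr
    exact abs_coord_le_norm x j
  have h1 : ∑' x, ‖toE x‖ ^ 2 * f x = ∑ j, ∑' x, f x * (x j : ℝ) ^ 2 := by
    rw [← Summable.tsum_finsetSum fun j _ => hsi j]
    refine tsum_congr fun x => ?_
    rw [norm_toE_sq, Finset.sum_mul]
    exact Finset.sum_congr rfl fun j _ => mul_comm _ _
  have h2 : ∀ j, ∑' x, f x * (x j : ℝ) ^ 2 = ∑' x, f x * (x i : ℝ) ^ 2 := fun j =>
    hf.tsum_coord (fun n => (n : ℝ) ^ 2) i j
  rw [h1, Finset.sum_congr rfl fun j _ => h2 j]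
  simp
  field_simp

theorem inner_toE (x : Fin d → ℤ) (k : EuclideanSpace ℝ (Fin d)) :
    inner ℝ (toE x) k = ∑ i, k i * (x i : ℝ) := by
  simp [PiLp.inner_apply, toE]

/-- The second moment matrix of a symmetric function is scalar: sign changes kill the off-diagonal
entries and permutations equate the diagonal ones. This is why the limit is isotropic. -/
theorem LatticeSymmetric.tsum_mul_inner_sq {f : (Fin d → ℤ) → ℝ} (hf : LatticeSymmetric f)
    (hs : Summable fun x => ‖toE x‖ ^ 2 * |f x|) (k : EuclideanSpace ℝ (Fin d)) :
    ∑' x, f x * (inner ℝ (toE x) k) ^ 2 = ‖k‖ ^ 2 * ((∑' x, ‖toE x‖ ^ 2 * f x) / d) := by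
  have hsij : ∀ i j, Summable fun x => f x * ((x i : ℝ) * x j) := fun i j => by
    refine Summable.of_norm_bounded hs fun x => ?_
    rw [norm_mul, norm_mul, Real.norm_eq_abs, Real.norm_eq_abs, Real.norm_eq_abs, mul_comm, sq]
    gcongr
    · exact abs_coord_le_norm x i
    · exact abs_coord_le_norm x j
  have h1 : ∀ x, f x * (inner ℝ (toE x) k) ^ 2 =
      ∑ i, ∑ j, (k i * k j) * (f x * ((x i : ℝ) * x j)) := fun x => by
    rw [inner_toE, sq, Finset.sum_mul_sum, Finset.mul_sum]
    refine Finset.sum_congr rfl fun i _ => ?_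
    rw [Finset.mul_sum]
    exact Finset.sum_congr rfl fun j _ => by ring
  simp_rw [h1]
  rw [Summable.tsum_finsetSum fun i _ => summable_sum fun j _ => (hsij i j).mul_left _]
  have h2 : ∀ i, ∑' x, ∑ j, (k i * k j) * (f x * ((x i : ℝ) * x j)) =
      k i ^ 2 * ((∑' x, ‖toE x‖ ^ 2 * f x) / d) := fun i => by
    rw [Summable.tsum_finsetSum fun j _ => (hsij i j).mul_left _]
    simp_rw [tsum_mul_left]
    rw [Finset.sum_eq_single i]
    · simp_rw [← sq]
      rw [hf.tsum_mul_coord_sq hs]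
    · intro j _ hj
      rw [hf.tsum_mul_coord_mul_coord hj.symm, mul_zero]
    · simp
  rw [Finset.sum_congr rfl fun i _ => h2 i, ← Finset.sum_mul, EuclideanSpace.norm_sq_eq]
  simp

/-! ### Elementary Taylor bounds -/

theorem abs_rpow_ge_of_le_one {u a b : ℝ} (hu : |u| ≤ 1) (ha : 0 ≤ a) (hab : a ≤ b) :
    |u| ^ b ≤ |u| ^ a := by
  rcases ha.eq_or_lt with rfl | ha
  · rw [Real.rpow_zero]; exact Real.rpow_le_one (abs_nonneg u) hu hab
  rcases (abs_nonneg u).eq_or_lt with h | h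
  · rw [← h, Real.zero_rpow ha.ne', Real.zero_rpow (by linarith)]
  · exact Real.rpow_le_rpow_of_exponent_ge h hu hab

/-- For `|u| ≤ 1` this is the cubic Taylor bound for `exp`, averaged over `±u`, and `η ≤ 1` lets the
cube be weakened; for `|u| ≥ 1`, `u² cosh u` already dominates. The factor `cosh u` on the right is
affordable since it is absorbed by the tilted moment bounds on `J`. -/
theorem abs_cosh_sub_le {η : ℝ} (h0 : 0 ≤ η) (h1 : η ≤ 1) (u : ℝ) :
    |Real.cosh u - 1 - u ^ 2 / 2| ≤ |u| ^ (2 + η) * Real.cosh u := by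
  have hc := Real.one_le_cosh u
  rcases le_total |u| 1 with hu | hu
  · have e1 := Real.exp_bound (x := u) hu (n := 3) (by norm_num)
    have e2 := Real.exp_bound (x := -u) (by simpa using hu) (n := 3) (by norm_num)
    rw [abs_neg] at e2
    have h3 : |u| ^ 3 ≤ |u| ^ (2 + η) := by
      rw [← Real.rpow_natCast |u| 3]
      exact abs_rpow_ge_of_le_one hu (by linarith) (by push_cast; linarith)
    have h4 : |u| ^ (2 + η) * 1 ≤ |u| ^ (2 + η) * Real.cosh u := by gcongr
    have h5 : |Real.cosh u - 1 - u ^ 2 / 2| ≤ |u| ^ 3 := by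
      simp only [Finset.sum_range_succ, Finset.sum_range_zero, Nat.factorial] at e1 e2
      norm_num at e1 e2
      rw [Real.cosh_eq]
      have := pow_nonneg (abs_nonneg u) 3
      rw [abs_le] at e1 e2 ⊢
      constructor <;> linarith [e1.1, e1.2, e2.1, e2.2]
    linarith
  · have h2 : u ^ 2 ≤ |u| ^ (2 + η) := by
      rw [← sq_abs, ← Real.rpow_two]
      exact Real.rpow_le_rpow_of_exponent_le hu (by linarith)
    have h3 : 1 ≤ u ^ 2 := by rw [← sq_abs]; nlinarith
    have h4 : u ^ 2 * Real.cosh u ≤ |u| ^ (2 + η) * Real.cosh u := by gcongr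
    rw [abs_le]
    constructor <;> nlinarith

theorem abs_one_sub_cos_sub_le {η : ℝ} (h0 : 0 ≤ η) (h1 : η ≤ 1) (u : ℝ) :
    |1 - Real.cos u - u ^ 2 / 2| ≤ |u| ^ (2 + η) := by
  rcases le_total |u| 1 with hu | hu
  · have h3 : |u| ^ 4 ≤ |u| ^ (2 + η) := by
      rw [← Real.rpow_natCast |u| 4]
      exact abs_rpow_ge_of_le_one hu (by linarith) (by push_cast; linarith)
    have e := Real.cos_bound hu
    have := pow_nonneg (abs_nonneg u) 4
    rw [abs_le] at e ⊢
    constructor <;> linarith [e.1, e.2]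
  · have h2 : u ^ 2 ≤ |u| ^ (2 + η) := by
      rw [← sq_abs, ← Real.rpow_two]
      exact Real.rpow_le_rpow_of_exponent_le hu (by linarith)
    have e1 := Real.one_sub_sq_div_two_le_cos (x := u)
    have e2 := Real.cos_le_one u
    rw [abs_le]
    constructor <;> nlinarith [sq_nonneg u]

theorem abs_one_sub_cos_le {η : ℝ} (h0 : 0 ≤ η) (h1 : η ≤ 1) (u : ℝ) :
    |1 - Real.cos u| ≤ 2 * |u| ^ η := by
  have e1 := Real.one_sub_sq_div_two_le_cos (x := u)
  have e2 := Real.cos_le_one u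
  have e3 := Real.neg_one_le_cos u
  rw [abs_of_nonneg (by linarith)]
  rcases le_total |u| 1 with hu | hu
  · have h3 : |u| ^ (2 : ℝ) ≤ |u| ^ η := abs_rpow_ge_of_le_one hu h0 (by linarith)
    rw [Real.rpow_two, sq_abs] at h3
    nlinarith [sq_nonneg u]
  · have h3 : 1 ≤ |u| ^ η := Real.one_le_rpow hu h0
    linarith

/-! ### Second-order expansions of the cosine and exponential sums. -/

/-- The cosine transform `∑_x f(x) cos(k·x)`. -/
noncomputable def cosSum (f : (Fin d → ℤ) → ℝ) (k : EuclideanSpace ℝ (Fin d)) : ℝ :=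
  ∑' x, f x * Real.cos (inner ℝ (toE x) k)

/-- The exponential sum `∑_x f(x) e^{t x_1}`. -/
noncomputable def expSum [NeZero d] (f : (Fin d → ℤ) → ℝ) (t : ℝ) : ℝ :=
  ∑' x, f x * Real.exp (t * x 0)

theorem cosSum_zero (f : (Fin d → ℤ) → ℝ) : cosSum f 0 = ∑' x, f x := by
  simp [cosSum]

theorem tilt_zero (f : (Fin d → ℤ) → ℝ) : tilt f 0 = f := by
  funext x; simp [tilt]

theorem hatZero_tilt_e1 [NeZero d] (f : (Fin d → ℤ) → ℝ) (t : ℝ) :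
    hatZero (tilt f (e1 t)) = expSum f t := by
  rw [hatZero_eq_tsum, expSum]
  exact tsum_congr fun x => tilt_e1 f t x

theorem LatticeSymmetric.tsum_mul_cexp {f : (Fin d → ℤ) → ℝ} (hf : LatticeSymmetric f)
    (hs : Summable fun x => |f x|) (k : EuclideanSpace ℝ (Fin d)) :
    ∑' x, (f x : ℂ) * Complex.exp ((inner ℝ (toE x) k : ℝ) * Complex.I) = (cosSum f k : ℂ) := by
  have hsum : Summable fun x => (f x : ℂ) * Complex.exp ((inner ℝ (toE x) k : ℝ) * Complex.I) := by
    refine Summable.of_norm (hs.congr fun x => ?_)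
    rw [norm_mul, Complex.norm_exp_ofReal_mul_I, mul_one, Complex.norm_real, Real.norm_eq_abs]
  have hneg : ∀ x : Fin d → ℤ, inner ℝ (toE (-x)) k = -inner ℝ (toE x) k := fun x => by
    rw [inner_toE, inner_toE, ← Finset.sum_neg_distrib]
    exact Finset.sum_congr rfl fun i _ => by simp
  have hre : ∀ x, ((f x : ℂ) * Complex.exp ((inner ℝ (toE x) k : ℝ) * Complex.I)).re =
      f x * Real.cos (inner ℝ (toE x) k) := fun x => by
    rw [Complex.re_ofReal_mul, Complex.exp_ofReal_mul_I_re]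
  have him : ∀ x, ((f x : ℂ) * Complex.exp ((inner ℝ (toE x) k : ℝ) * Complex.I)).im =
      f x * Real.sin (inner ℝ (toE x) k) := fun x => by
    rw [Complex.im_ofReal_mul, Complex.exp_ofReal_mul_I_im]
  apply Complex.ext
  · rw [Complex.re_tsum hsum, Complex.ofReal_re, cosSum]
    exact tsum_congr hre
  · rw [Complex.im_tsum hsum, Complex.ofReal_im, tsum_congr him]
    have h := (Equiv.neg (Fin d → ℤ)).tsum_eq fun x => f x * Real.sin (inner ℝ (toE x) k)
    simp only [Equiv.neg_apply, hf.comp_neg, hneg, Real.sin_neg, mul_neg, tsum_neg] at h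
    linarith

/-- Averaging over `x_1 ↦ -x_1` removes the odd part, so expansions in `t` have no first-order term.
-/
theorem expSum_eq_cosh [NeZero d] {f : (Fin d → ℤ) → ℝ} (hf : LatticeSymmetric f) {t : ℝ}
    (hs : Summable fun x => f x * Real.exp (t * x 0)) :
    (Summable fun x => f x * Real.cosh (t * x 0)) ∧
      ∑' x, f x * Real.cosh (t * x 0) = expSum f t := by
  have h1 := hf.summable_neg_coord (fun n => Real.exp (t * n)) 0 hs
  have h2 := hf.tsum_neg_coord (fun n => Real.exp (t * n)) 0
  simp only [Int.cast_neg, mul_neg] at h1 h2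
  have h3 : ∀ x : Fin d → ℤ, f x * Real.cosh (t * x 0) =
      (f x * Real.exp (t * x 0) + f x * Real.exp (-(t * x 0))) / 2 := fun x => by
    rw [Real.cosh_eq]; ring
  simp_rw [h3]
  refine ⟨(hs.add h1).div_const 2, ?_⟩
  rw [tsum_div_const, hs.tsum_add h1, h2, expSum]
  ring

/-- After symmetrisation the Taylor remainder is bounded by `t^{2+η} ∑ |x|^{2+ζ} |f(x)| cosh(t
x_1)`. Undoing the symmetrisation for the symmetric weight `|x|^{2+ζ} |f|` turns this sum into the
weighted norm of the tilt, so the bound is uniform up to the edge of `Ω`. -/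
theorem abs_expSum_sub_le [NeZero d] {f : (Fin d → ℤ) → ℝ} (hf : LatticeSymmetric f)
    (hs : Summable fun x => |f x|) (hs2 : Summable fun x => ‖toE x‖ ^ 2 * |f x|)
    {M ζ η t : ℝ} (hM : 0 ≤ M) (ht : 0 ≤ t) (h0 : 0 ≤ η) (h1 : η ≤ 1) (hηζ : η ≤ ζ)
    (hb : weightedNorm 0 1 (tilt f (e1 t)) ≤ ENNReal.ofReal M)
    (hb2 : weightedNorm (2 + ζ) 1 (tilt f (e1 t)) ≤ ENNReal.ofReal M) :
    |expSum f t - ∑' x, f x - t ^ 2 / 2 * ((∑' x, ‖toE x‖ ^ 2 * f x) / d)| ≤ t ^ (2 + η) * M := by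
  obtain ⟨b1, -⟩ := summable_of_weightedNorm_le hM hb
  obtain ⟨b2, b2'⟩ := summable_of_weightedNorm_le hM hb2
  simp only [tilt_e1, abs_mul, Real.abs_exp, Real.rpow_zero, one_mul, ← mul_assoc] at b1 b2 b2'
  have hexp : Summable fun x => f x * Real.exp (t * x 0) := by
    refine Summable.of_norm (b1.congr fun x => ?_)
    rw [norm_mul, Real.norm_eq_abs, Real.norm_eq_abs, Real.abs_exp]
  obtain ⟨c1, c2⟩ := expSum_eq_cosh hf hexp
  have hw : LatticeSymmetric fun x : Fin d → ℤ => ‖toE x‖ ^ (2 + ζ) * |f x| :=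
    (latticeSymmetric_comp_norm fun r => r ^ (2 + ζ)).mul hf.abs
  obtain ⟨w1, w2⟩ := expSum_eq_cosh hw b2
  have hsq : Summable fun x => f x * (x 0 : ℝ) ^ 2 := by
    refine Summable.of_norm_bounded hs2 fun x => ?_
    rw [norm_mul, Real.norm_eq_abs, Real.norm_of_nonneg (sq_nonneg _), mul_comm, ← sq_abs (x 0 : ℝ)]
    gcongr
    exact abs_coord_le_norm x 0
  have hid : expSum f t - ∑' x, f x - t ^ 2 / 2 * ((∑' x, ‖toE x‖ ^ 2 * f x) / d) =
      ∑' x, f x * (Real.cosh (t * x 0) - 1 - (t * x 0) ^ 2 / 2) := by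
    rw [← hf.tsum_mul_coord_sq hs2 0, ← c2, ← tsum_mul_left, ← c1.tsum_sub hs.of_abs,
      ← (c1.sub hs.of_abs).tsum_sub (hsq.mul_left _)]
    exact tsum_congr fun x => by ring
  rw [hid, ← Real.norm_eq_abs]
  have hle : ∀ x : Fin d → ℤ, ‖f x * (Real.cosh (t * x 0) - 1 - (t * x 0) ^ 2 / 2)‖ ≤
      t ^ (2 + η) * (‖toE x‖ ^ (2 + ζ) * |f x| * Real.cosh (t * x 0)) := fun x => by
    rw [norm_mul, Real.norm_eq_abs, Real.norm_eq_abs]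
    have e1 := abs_cosh_sub_le h0 h1 (t * x 0)
    have e2 : |t * (x 0 : ℝ)| ^ (2 + η) ≤ t ^ (2 + η) * ‖toE x‖ ^ (2 + ζ) := by
      rw [abs_mul, abs_of_nonneg ht, Real.mul_rpow ht (abs_nonneg _)]
      gcongr
      exact (Real.rpow_le_rpow (abs_nonneg _) (abs_coord_le_norm x 0) (by linarith)).trans
        (norm_toE_rpow_le_rpow (by linarith) (by linarith) x)
    have e3 := (Real.cosh_pos (t * x 0)).le
    calc |f x| * |Real.cosh (t * x 0) - 1 - (t * x 0) ^ 2 / 2|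
        ≤ |f x| * (t ^ (2 + η) * ‖toE x‖ ^ (2 + ζ) * Real.cosh (t * x 0)) := by
          gcongr
          exact e1.trans (by gcongr)
      _ = _ := by ring
  refine (tsum_of_norm_bounded (w1.mul_left _).hasSum hle).trans ?_
  rw [tsum_mul_left, w2]
  gcongr
  exact b2'

/-- This is the counterpart of `abs_expSum_sub_le` at an imaginary tilt. As `cos` is bounded, the
untilted moment suffices. -/
theorem abs_sub_cosSum_sub_le {f : (Fin d → ℤ) → ℝ} (hf : LatticeSymmetric f)
    (hs : Summable fun x => |f x|) (hs2 : Summable fun x => ‖toE x‖ ^ 2 * |f x|)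
    {M ζ η : ℝ} (hM : 0 ≤ M) (h0 : 0 ≤ η) (h1 : η ≤ 1) (hηζ : η ≤ ζ)
    (hb : weightedNorm (2 + ζ) 1 f ≤ ENNReal.ofReal M) (k : EuclideanSpace ℝ (Fin d)) :
    |∑' x, f x - cosSum f k - ‖k‖ ^ 2 / 2 * ((∑' x, ‖toE x‖ ^ 2 * f x) / d)| ≤
      ‖k‖ ^ (2 + η) * M := by
  obtain ⟨b, b'⟩ := summable_of_weightedNorm_le hM hb
  have hcos : Summable fun x => f x * Real.cos (inner ℝ (toE x) k) := by
    refine Summable.of_norm_bounded hs fun x => ?_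
    rw [norm_mul, Real.norm_eq_abs, Real.norm_eq_abs]
    exact mul_le_of_le_one_right (abs_nonneg _) (Real.abs_cos_le_one _)
  have hin : ∀ x : Fin d → ℤ, |inner ℝ (toE x) k| ≤ ‖k‖ * ‖toE x‖ := fun x => by
    rw [mul_comm]; exact abs_real_inner_le_norm _ _
  have hsq : Summable fun x => f x * (inner ℝ (toE x) k) ^ 2 := by
    refine Summable.of_norm_bounded (hs2.mul_left (‖k‖ ^ 2)) fun x => ?_
    rw [norm_mul, Real.norm_eq_abs, Real.norm_of_nonneg (sq_nonneg _), mul_comm, ← mul_assoc,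
      ← mul_pow, ← sq_abs (inner ℝ (toE x) k)]
    gcongr
    exact hin x
  have hid : ∑' x, f x - cosSum f k - ‖k‖ ^ 2 / 2 * ((∑' x, ‖toE x‖ ^ 2 * f x) / d) =
      ∑' x, f x * (1 - Real.cos (inner ℝ (toE x) k) - (inner ℝ (toE x) k) ^ 2 / 2) := by
    rw [div_mul_eq_mul_div, ← hf.tsum_mul_inner_sq hs2 k, cosSum, ← tsum_div_const,
      ← hs.of_abs.tsum_sub hcos, ← (hs.of_abs.sub hcos).tsum_sub (hsq.div_const 2)]
    exact tsum_congr fun x => by ring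
  rw [hid, ← Real.norm_eq_abs]
  have hle : ∀ x : Fin d → ℤ,
      ‖f x * (1 - Real.cos (inner ℝ (toE x) k) - (inner ℝ (toE x) k) ^ 2 / 2)‖ ≤
      ‖k‖ ^ (2 + η) * (‖toE x‖ ^ (2 + ζ) * |f x|) := fun x => by
    rw [norm_mul, Real.norm_eq_abs, Real.norm_eq_abs]
    have e2 : |inner ℝ (toE x) k| ^ (2 + η) ≤ ‖k‖ ^ (2 + η) * ‖toE x‖ ^ (2 + ζ) := by
      refine (Real.rpow_le_rpow (abs_nonneg _) (hin x) (by linarith)).trans ?_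
      rw [Real.mul_rpow (norm_nonneg _) (norm_nonneg _)]
      exact mul_le_mul_of_nonneg_left
        (norm_toE_rpow_le_rpow (by linarith) (by linarith) x) (by positivity)
    calc |f x| * |1 - Real.cos (inner ℝ (toE x) k) - (inner ℝ (toE x) k) ^ 2 / 2|
        ≤ |f x| * (‖k‖ ^ (2 + η) * ‖toE x‖ ^ (2 + ζ)) := by
          gcongr
          exact (abs_one_sub_cos_sub_le h0 h1 _).trans e2
      _ = _ := by ring
  refine (tsum_of_norm_bounded (b.mul_left _).hasSum hle).trans ?_
  rw [tsum_mul_left]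
  gcongr

theorem abs_sub_cosSum_le {f : (Fin d → ℤ) → ℝ} (hs : Summable fun x => |f x|)
    {M ζ η : ℝ} (hM : 0 ≤ M) (h0 : 0 < η) (h1 : η ≤ 1) (hηζ : η ≤ ζ)
    (hb : weightedNorm ζ 1 f ≤ ENNReal.ofReal M) (k : EuclideanSpace ℝ (Fin d)) :
    |∑' x, f x - cosSum f k| ≤ 2 * ‖k‖ ^ η * M := by
  obtain ⟨b, b'⟩ := summable_of_weightedNorm_le hM hb
  have hcos : Summable fun x => f x * Real.cos (inner ℝ (toE x) k) := by
    refine Summable.of_norm_bounded hs fun x => ?_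
    rw [norm_mul, Real.norm_eq_abs, Real.norm_eq_abs]
    exact mul_le_of_le_one_right (abs_nonneg _) (Real.abs_cos_le_one _)
  have hid : ∑' x, f x - cosSum f k = ∑' x, f x * (1 - Real.cos (inner ℝ (toE x) k)) := by
    rw [cosSum, ← hs.of_abs.tsum_sub hcos]
    exact tsum_congr fun x => by ring
  rw [hid, ← Real.norm_eq_abs]
  have hle : ∀ x : Fin d → ℤ, ‖f x * (1 - Real.cos (inner ℝ (toE x) k))‖ ≤
      2 * ‖k‖ ^ η * (‖toE x‖ ^ ζ * |f x|) := fun x => by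
    rw [norm_mul, Real.norm_eq_abs, Real.norm_eq_abs]
    have e2 : |inner ℝ (toE x) k| ^ η ≤ ‖k‖ ^ η * ‖toE x‖ ^ ζ := by
      refine (Real.rpow_le_rpow (abs_nonneg _) (abs_real_inner_le_norm _ _) h0.le).trans ?_
      rw [mul_comm, Real.mul_rpow (norm_nonneg _) (norm_nonneg _)]
      exact mul_le_mul_of_nonneg_left (norm_toE_rpow_le_rpow h0 hηζ x) (by positivity)
    calc |f x| * |1 - Real.cos (inner ℝ (toE x) k)|
        ≤ |f x| * (2 * (‖k‖ ^ η * ‖toE x‖ ^ ζ)) := by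
          gcongr
          exact (abs_one_sub_cos_le h0.le h1 _).trans (by gcongr)
      _ = _ := by ring
  refine (tsum_of_norm_bounded (b.mul_left _).hasSum hle).trans ?_
  rw [tsum_mul_left]
  gcongr

theorem re_fourier_sub {f : (Fin d → ℤ) → ℝ} (hs : Summable fun x => |f x|)
    (k : EuclideanSpace ℝ (Fin d)) : (fourier f 0 - fourier f k).re = ∑' x, f x - cosSum f k := by
  have hsum : Summable fun x => (f x : ℂ) *
      Complex.exp (-(Complex.I * ((inner ℝ k (toE x) : ℝ) : ℂ))) := by
    refine Summable.of_norm (hs.congr fun x => ?_)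
    rw [norm_mul, ← mul_neg, ← Complex.ofReal_neg, Complex.norm_exp_I_mul_ofReal, mul_one,
      Complex.norm_real, Real.norm_eq_abs]
  rw [Complex.sub_re, fourier_zero, Complex.ofReal_re, fourier, Complex.re_tsum hsum, cosSum]
  congr 1
  refine tsum_congr fun x => ?_
  rw [Complex.re_ofReal_mul, ← mul_neg, ← Complex.ofReal_neg, mul_comm Complex.I,
    Complex.exp_ofReal_mul_I_re, Real.cos_neg, real_inner_comm]

/-- This provides one summable majorant for all tilts between `0` and `t`. -/
theorem exp_mul_le_one_add_exp {s t : ℝ} (hs : 0 ≤ s) (hst : s ≤ t) (u : ℝ) :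
    Real.exp (s * u) ≤ 1 + Real.exp (t * u) := by
  rcases le_total 0 u with hu | hu
  · have : Real.exp (s * u) ≤ Real.exp (t * u) := Real.exp_le_exp.2 (by gcongr)
    linarith
  · have : Real.exp (s * u) ≤ 1 := Real.exp_le_one_iff.2 (mul_nonpos_of_nonneg_of_nonpos hs hu)
    linarith [Real.exp_pos (t * u)]

/-! ### The mass as the edge of `Ω` along the first axis. -/

section Mass

variable [NeZero d] {S : (Fin d → ℤ) → ℝ}

theorem e1_mem_Omega {t : ℝ} :
    e1 t ∈ Omega S ↔ Summable fun x => S x * Real.exp (t * x 0) := by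
  simp only [Omega, Set.mem_ofPred_eq]
  exact summable_congr fun x => tilt_e1 S t x

theorem ExpDecay.summable (hS : ExpDecay S) : Summable S := by
  have h := hS.zero_mem
  rw [← e1_zero, e1_mem_Omega] at h
  simpa using h

theorem ExpDecay.e1_mem_Omega_of_le (hS : ExpDecay S) {s t : ℝ} (hs : 0 ≤ s) (hst : s ≤ t)
    (ht : e1 t ∈ Omega S) : e1 s ∈ Omega S := by
  rw [e1_mem_Omega] at ht ⊢
  refine Summable.of_nonneg_of_le (fun x => mul_nonneg (hS.nonneg x) (Real.exp_pos _).le)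
    (fun x => ?_) (hS.summable.add ht)
  have := mul_le_mul_of_nonneg_left (exp_mul_le_one_add_exp hs hst (x 0 : ℝ)) (hS.nonneg x)
  linarith

theorem ExpDecay.bddAbove (hS : ExpDecay S) : BddAbove {t : ℝ | 0 ≤ t ∧ e1 t ∈ Omega S} := by
  obtain ⟨T, hT, hTn⟩ := hS.exists_not_mem
  refine ⟨T, fun t ht => ?_⟩
  by_contra! h
  exact hTn (hS.e1_mem_Omega_of_le hT.le h.le ht.2)

theorem ExpDecay.exists_gt_e1_mem (hS : ExpDecay S) {t : ℝ} (ht : e1 t ∈ Omega S) :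
    ∃ s, t < s ∧ e1 s ∈ Omega S := by
  have h : e1 ⁻¹' Omega S ∈ 𝓝 t := (hS.isOpen.preimage continuous_e1).mem_nhds ht
  have h2 : ∀ᶠ s in 𝓝[>] t, s ∈ e1 ⁻¹' Omega S := mem_nhdsWithin_of_mem_nhds h
  obtain ⟨s, hs, hs'⟩ := (h2.and self_mem_nhdsWithin).exists
  exact ⟨s, hs', hs⟩

theorem ExpDecay.mass_pos (hS : ExpDecay S) : 0 < mass S := by
  have h0 : (e1 0 : EuclideanSpace ℝ (Fin d)) ∈ Omega S := by rw [e1_zero]; exact hS.zero_mem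
  obtain ⟨s, hs, hs'⟩ := hS.exists_gt_e1_mem h0
  exact hs.trans_le (le_csSup hS.bddAbove ⟨hs.le, hs'⟩)

theorem ExpDecay.e1_mem_of_lt_mass (hS : ExpDecay S) {t : ℝ} (h0 : 0 ≤ t) (ht : t < mass S) :
    e1 t ∈ Omega S := by
  have hne : {t : ℝ | 0 ≤ t ∧ e1 t ∈ Omega S}.Nonempty :=
    ⟨0, le_rfl, by rw [e1_zero]; exact hS.zero_mem⟩
  obtain ⟨s, hs, hts⟩ := exists_lt_of_lt_csSup hne ht
  exact hS.e1_mem_Omega_of_le h0 hts.le hs.2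

/-- Since `Ω` is open, the supremum is not attained. -/
theorem ExpDecay.e1_mass_not_mem (hS : ExpDecay S) : e1 (mass S) ∉ Omega S := fun h => by
  obtain ⟨s, hs, hs'⟩ := hS.exists_gt_e1_mem h
  exact absurd (le_csSup hS.bddAbove ⟨hS.mass_pos.le.trans hs.le, hs'⟩) (not_le.2 hs)

theorem ExpDecay.eventually_lt_mass (hS : ExpDecay S) :
    ∀ᶠ t in 𝓝[<] mass S, t ∈ Set.Ioo 0 (mass S) := Ioo_mem_nhdsLT hS.mass_pos

/-- The endpoint `t = m` is included, so the uniform class bounds hold for the critical tilt itself,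
where `S` is no longer summable. -/
theorem ExpDecay.e1_mem_closure (hS : ExpDecay S) {t : ℝ} (h0 : 0 ≤ t) (ht : t ≤ mass S) :
    e1 t ∈ closure (Omega S) := by
  rcases ht.eq_or_lt with rfl | ht
  · refine mem_closure_of_tendsto (continuous_e1.tendsto (mass S) |>.mono_left
      (nhdsWithin_le_nhds (s := Set.Iio (mass S)))) ?_
    filter_upwards [hS.eventually_lt_mass] with s hs
    exact hS.e1_mem_of_lt_mass hs.1.le hs.2
  · exact subset_closure (hS.e1_mem_of_lt_mass h0 ht)

end Mass

/-! ### Consequences of the Ornstein–Zernike equation at one parameter. -/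

/-- The hypotheses on `(S, J, h)` at one parameter value, with explicit constants. -/
structure OZBounds [NeZero d] (M K ζ : ℝ) (S J h : (Fin d → ℤ) → ℝ) : Prop where
  decay : ExpDecay S
  oz : OZEquation S J h
  M_pos : 0 < M
  bounds : ∀ μ ∈ closure (Omega S),
    QClass M K ζ (tilt J μ) (tilt h μ) ∧ M⁻¹ ≤ hatZero (tilt h μ)

namespace OZBounds

variable [NeZero d] {M K ζ : ℝ} {S J h : (Fin d → ℤ) → ℝ}

theorem qClass (H : OZBounds M K ζ S J h) : QClass M K ζ J h := by
  have := (H.bounds 0 (subset_closure H.decay.zero_mem)).1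
  rwa [tilt_zero, tilt_zero] at this

theorem inv_le_tsum (H : OZBounds M K ζ S J h) : M⁻¹ ≤ ∑' x, h x := by
  have := (H.bounds 0 (subset_closure H.decay.zero_mem)).2
  rwa [tilt_zero, hatZero_eq_tsum] at this

theorem inv_le_expSum (H : OZBounds M K ζ S J h) {t : ℝ} (h0 : 0 ≤ t) (ht : t ≤ mass S) :
    M⁻¹ ≤ expSum h t := by
  rw [← hatZero_tilt_e1]
  exact (H.bounds _ (H.decay.e1_mem_closure h0 ht)).2

theorem summable_sq (H : OZBounds M K ζ S J h) (hζ : 0 ≤ ζ) :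
    Summable fun x => ‖toE x‖ ^ 2 * |J x| := by
  refine Summable.of_nonneg_of_le (fun x => by positivity) (fun x => ?_)
    (summable_of_weightedNorm_le H.M_pos.le H.qClass.Q_moment).1
  rw [← Real.rpow_two]
  exact mul_le_mul_of_nonneg_right (norm_toE_rpow_le_rpow two_pos (by linarith) x) (abs_nonneg _)

theorem summable_J_exp (H : OZBounds M K ζ S J h) {t : ℝ} (h0 : 0 ≤ t) (ht : t ≤ mass S) :
    Summable fun x => |J x| * Real.exp (t * x 0) := by
  have := (summable_of_weightedNorm_le H.M_pos.le
    (H.bounds _ (H.decay.e1_mem_closure h0 ht)).1.Q_norm).1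
  simpa only [tilt_e1, abs_mul, Real.abs_exp, Real.rpow_zero, one_mul] using this

theorem summable_h_exp (H : OZBounds M K ζ S J h) {t : ℝ} (h0 : 0 ≤ t) (ht : t ≤ mass S) :
    (Summable fun x => |h x| * Real.exp (t * x 0)) ∧ expSum h t ≤ M := by
  have := summable_of_weightedNorm_le H.M_pos.le
    (H.bounds _ (H.decay.e1_mem_closure h0 ht)).1.g_norm
  simp only [tilt_e1, abs_mul, Real.abs_exp, Real.rpow_zero, one_mul] at this
  refine ⟨this.1, le_trans ?_ this.2⟩
  have hle : ∀ x : Fin d → ℤ, h x * Real.exp (t * x 0) ≤ |h x| * Real.exp (t * x 0) := fun x =>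
    mul_le_mul_of_nonneg_right (le_abs_self _) (Real.exp_pos _).le
  refine Summable.tsum_le_tsum hle (Summable.of_norm (this.1.congr fun x => ?_)) this.1
  rw [norm_mul, Real.norm_eq_abs, Real.norm_eq_abs, Real.abs_exp]

theorem summable_S_exp (H : OZBounds M K ζ S J h) {t : ℝ} (h0 : 0 ≤ t) (ht : t < mass S) :
    Summable fun x => S x * Real.exp (t * x 0) :=
  e1_mem_Omega.1 (H.decay.e1_mem_of_lt_mass h0 ht)

theorem expSum_mul (H : OZBounds M K ζ S J h) {t : ℝ} (h0 : 0 ≤ t) (ht : t < mass S) :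
    expSum S t * (1 - expSum J t) = expSum h t := by
  have := tsum_mul_one_sub_of_convolution (𝕜 := ℝ) H.oz.eqn
    (e := fun x => Real.exp (t * x 0)) (fun x y => by
      rw [← Real.exp_add]; congr 1; simp; ring) ?_ ?_ ?_
  · simpa [expSum] using this
  · refine (H.summable_S_exp h0 ht).congr fun x => ?_
    rw [abs_of_nonneg (H.decay.nonneg x), Real.norm_eq_abs, Real.abs_exp]
  · refine (H.summable_J_exp h0 ht.le).congr fun x => ?_
    rw [Real.norm_eq_abs, Real.abs_exp]
  · refine (H.summable_h_exp h0 ht.le).1.congr fun x => ?_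
    rw [Real.norm_eq_abs, Real.abs_exp]

theorem cosSum_mul (H : OZBounds M K ζ S J h) (k : EuclideanSpace ℝ (Fin d)) :
    cosSum S k * (1 - cosSum J k) = cosSum h k := by
  have hadd : ∀ x y : Fin d → ℤ, inner ℝ (toE (x + y)) k = inner ℝ (toE x) k + inner ℝ (toE y) k :=
    fun x y => by
      rw [← inner_add_left]; congr 1; ext i; simp [toE]
  have := tsum_mul_one_sub_of_convolution (𝕜 := ℂ) H.oz.eqn
    (e := fun x => Complex.exp ((inner ℝ (toE x) k : ℝ) * Complex.I)) (fun x y => by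
      rw [← Complex.exp_add, hadd]; congr 1; push_cast; ring) ?_ ?_ ?_
  · simp only [Complex.coe_algebraMap] at this
    rw [H.decay.symm.tsum_mul_cexp H.decay.summable.abs, H.oz.J_symm.tsum_mul_cexp H.oz.J_summable,
      H.oz.h_symm.tsum_mul_cexp H.oz.h_summable] at this
    exact_mod_cast this
  · simpa [Complex.norm_exp_ofReal_mul_I] using H.decay.summable.abs
  · simpa [Complex.norm_exp_ofReal_mul_I] using H.oz.J_summable
  · simpa [Complex.norm_exp_ofReal_mul_I] using H.oz.h_summable

/-- The terms are dominated by `|J(x)| (1 + e^{m x_1})`, summable because the bounds on `J` reach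
the endpoint `m`. -/
theorem continuousOn_expSum (H : OZBounds M K ζ S J h) :
    ContinuousOn (expSum J) (Set.Icc 0 (mass S)) := by
  refine continuousOn_tsum (fun x => by fun_prop)
    (H.oz.J_summable.add (H.summable_J_exp H.decay.mass_pos.le le_rfl)) fun x t ht => ?_
  rw [norm_mul, Real.norm_eq_abs, Real.norm_eq_abs, Real.abs_exp]
  have := mul_le_mul_of_nonneg_left (exp_mul_le_one_add_exp ht.1 ht.2 (x 0 : ℝ)) (abs_nonneg (J x))
  linarith

theorem expSum_S_nonneg (H : OZBounds M K ζ S J h) (t : ℝ) : 0 ≤ expSum S t :=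
  tsum_nonneg fun x => mul_nonneg (H.decay.nonneg x) (Real.exp_pos _).le

/-- In the product identity the right side is at least `M⁻¹ > 0` and the tilted susceptibility is
nonnegative, so the other factor is positive. -/
theorem expSum_J_lt_one (H : OZBounds M K ζ S J h) {t : ℝ} (h0 : 0 ≤ t) (ht : t < mass S) :
    expSum J t < 1 := by
  have h1 := H.expSum_mul h0 ht
  have h2 := H.inv_le_expSum h0 ht.le
  have h3 := inv_pos.2 H.M_pos
  have h4 := H.expSum_S_nonneg t
  by_contra! h5
  nlinarith [mul_nonneg h4 (sub_nonneg.2 h5)]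

/-- The tilted `J` has total mass one at the edge of `Ω`. -/
theorem expSum_J_mass (H : OZBounds M K ζ S J h) : expSum J (mass S) = 1 := by
  have hm := H.decay.mass_pos
  have hlim : Tendsto (expSum J) (𝓝[<] mass S) (𝓝 (expSum J (mass S))) :=
    ((H.continuousOn_expSum (mass S) ⟨hm.le, le_rfl⟩).mono_of_mem_nhdsWithin
      (mem_of_superset (Ioo_mem_nhdsLT hm) Set.Ioo_subset_Icc_self)).tendsto
  have hle : expSum J (mass S) ≤ 1 := by
    refine le_of_tendsto hlim ?_
    filter_upwards [H.decay.eventually_lt_mass] with t ht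
    exact (H.expSum_J_lt_one ht.1.le ht.2).le
  by_contra hne
  have hlt : expSum J (mass S) < 1 := lt_of_le_of_ne hle hne
  obtain ⟨c, hc, hc1⟩ := exists_between hlt
  -- If the limit were below `c < 1`, the product identity would bound the tilted susceptibility by
  -- `M / (1 - c)` as `t ↑ m`. Finite partial sums inherit this bound at `t = m`, making `S`
  -- summable there.
  refine H.decay.e1_mass_not_mem (e1_mem_Omega.2 ?_)
  refine summable_of_sum_le (c := M / (1 - c))
    (fun x => mul_nonneg (H.decay.nonneg x) (Real.exp_pos _).le) fun F => ?_
  have hF : Tendsto (fun t => ∑ x ∈ F, S x * Real.exp (t * x 0)) (𝓝[<] mass S)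
      (𝓝 (∑ x ∈ F, S x * Real.exp (mass S * x 0))) := by
    refine Tendsto.mono_left (Continuous.tendsto ?_ _) nhdsWithin_le_nhds
    fun_prop
  refine le_of_tendsto hF ?_
  filter_upwards [H.decay.eventually_lt_mass, hlim.eventually_lt_const hc] with t ht htc
  have e1 := H.expSum_mul ht.1.le ht.2
  have e2 := (H.summable_h_exp ht.1.le ht.2.le).2
  have e3 : ∑ x ∈ F, S x * Real.exp (t * x 0) ≤ expSum S t :=
    (H.summable_S_exp ht.1.le ht.2).sum_le_tsum F
      fun x _ => mul_nonneg (H.decay.nonneg x) (Real.exp_pos _).le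
  refine e3.trans ?_
  rw [le_div_iff₀ (by linarith)]
  nlinarith [H.expSum_S_nonneg t]

/-- The infrared bound at `k = s e_1`, compared with the expansion `s² σ² / (2d) + O(s^{2+η})`,
gives the claim on dividing by `s²` and letting `s → 0`. It keeps `σ` away from zero uniformly in
`z`. -/
theorem le_second_moment (H : OZBounds M K ζ S J h) (hζ : 0 < ζ) :
    2 * d * K ≤ ∑' x, ‖toE x‖ ^ 2 * J x := by
  have hd : (0 : ℝ) < d := by exact_mod_cast NeZero.pos d
  set η := min ζ 1 with hη
  have h0 : 0 < η := lt_min hζ one_pos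
  set V := (∑' x, ‖toE x‖ ^ 2 * J x) / d with hV
  suffices h : K ≤ V / 2 by
    rw [hV, div_div, le_div_iff₀ (by positivity)] at h
    linarith
  have hev : ∀ᶠ s in 𝓝[>] (0 : ℝ), K ≤ V / 2 + s ^ η * M := by
    filter_upwards [Ioo_mem_nhdsGT Real.pi_pos] with s hs
    have h1 := H.qClass.infrared (e1 s) (fun i => by
      by_cases hi : i = 0 <;> simp [e1, hi, abs_of_pos hs.1, hs.2.le, Real.pi_pos.le])
    rw [re_fourier_sub H.oz.J_summable, norm_e1, abs_of_pos hs.1] at h1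
    have h2 := abs_sub_cosSum_sub_le H.oz.J_symm H.oz.J_summable (H.summable_sq hζ.le) H.M_pos.le
      h0.le (min_le_right _ _) (min_le_left _ _) H.qClass.Q_moment (e1 s)
    rw [norm_e1, abs_of_pos hs.1, Real.rpow_add hs.1, Real.rpow_two] at h2
    have h3 := (abs_le.1 h2).2
    have hs2 : 0 < s ^ 2 := pow_pos hs.1 2
    refine le_of_mul_le_mul_left ?_ hs2
    nlinarith
  have hlim : Tendsto (fun s : ℝ => V / 2 + s ^ η * M) (𝓝[>] 0) (𝓝 (V / 2 + 0 ^ η * M)) := by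
    refine Tendsto.mono_left (Continuous.tendsto ?_ 0) nhdsWithin_le_nhds
    have := Real.continuous_rpow_const h0.le
    fun_prop
  rw [Real.zero_rpow h0.ne', zero_mul, add_zero] at hlim
  exact ge_of_tendsto hlim hev

/-- The square root in `sigma` truncates nothing, as the second moment is nonnegative. -/
theorem sigma_sq (H : OZBounds M K ζ S J h) (hζ : 0 < ζ) (hK : 0 ≤ K) :
    sigma J ^ 2 = ∑' x, ‖toE x‖ ^ 2 * J x :=
  Real.sq_sqrt ((by positivity : (0 : ℝ) ≤ 2 * d * K).trans (H.le_second_moment hζ))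

end OZBounds

/-! ### Exponential bounds on moments -/

theorem exists_rpow_le_exp {φ : ℝ} (hφ : 0 ≤ φ) :
    ∃ C : ℝ, 0 ≤ C ∧ ∀ y : ℝ, 0 ≤ y → y ^ φ ≤ C * Real.exp y := by
  obtain ⟨n, hn⟩ := exists_nat_ge φ
  refine ⟨1 + n.factorial, by positivity, fun y hy => ?_⟩
  have he : 1 ≤ Real.exp y := Real.one_le_exp hy
  have h1 : y ^ n ≤ n.factorial * Real.exp y := by
    have := Real.pow_div_factorial_le_exp y hy n
    rwa [div_le_iff₀ (by positivity), mul_comm] at this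
  have h2 : y ^ φ ≤ 1 + y ^ n := by
    rcases le_total y 1 with h | h
    · have := Real.rpow_le_one hy h hφ
      have := pow_nonneg hy n
      linarith
    · have := Real.rpow_le_rpow_of_exponent_le h hn
      rw [Real.rpow_natCast] at this
      linarith
  linarith

/-- The largest coordinate satisfies `a|x| ≤ 2d · (a/2)|x_i|`, and one of the two exponentials in
that coordinate dominates the power. The rate is `a/2` so that, for `a = m`, the tilt lies strictly
inside `Ω`. -/
theorem exists_norm_rpow_le_sum_exp {φ : ℝ} [NeZero d] (hφ : 0 ≤ φ) :
    ∃ C : ℝ, 0 ≤ C ∧ ∀ (a : ℝ) (x : Fin d → ℤ), 0 ≤ a → (a * ‖toE x‖) ^ φ ≤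
      C * ∑ i, (Real.exp (a / 2 * x i) + Real.exp (a / 2 * -x i)) := by
  obtain ⟨C, hC, hCe⟩ := exists_rpow_le_exp hφ
  refine ⟨(2 * d) ^ φ * C, by positivity, fun a x ha => ?_⟩
  obtain ⟨i, -, hi⟩ := Finset.exists_max_image Finset.univ (fun i => |(x i : ℝ)|)
    Finset.univ_nonempty
  have h1 : ‖toE x‖ ≤ d * |(x i : ℝ)| := by
    refine abs_le_of_sq_le_sq' ?_ (by positivity) |>.2
    rw [norm_toE_sq]
    calc ∑ j, (x j : ℝ) ^ 2 ≤ ∑ _j : Fin d, |(x i : ℝ)| ^ 2 := by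
          refine Finset.sum_le_sum fun j _ => ?_
          rw [← sq_abs]
          have := hi j (Finset.mem_univ _)
          gcongr
      _ = d * |(x i : ℝ)| ^ 2 := by simp
      _ ≤ (d * |(x i : ℝ)|) ^ 2 := by
          have : (1 : ℝ) ≤ d := by exact_mod_cast NeZero.one_le
          rw [mul_pow]
          gcongr
          nlinarith
  have h2 : Real.exp (a / 2 * |(x i : ℝ)|) ≤
      Real.exp (a / 2 * x i) + Real.exp (a / 2 * -x i) := by
    rcases abs_cases (x i : ℝ) with h | h <;> rw [h.1]
    · linarith [Real.exp_pos (a / 2 * -x i)]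
    · linarith [Real.exp_pos (a / 2 * x i)]
  calc (a * ‖toE x‖) ^ φ ≤ (2 * d * (a / 2 * |(x i : ℝ)|)) ^ φ := by
        refine Real.rpow_le_rpow (by positivity) ?_ hφ
        nlinarith
    _ = (2 * d) ^ φ * (a / 2 * |(x i : ℝ)|) ^ φ := Real.mul_rpow (by positivity) (by positivity)
    _ ≤ (2 * d) ^ φ * (C * Real.exp (a / 2 * |(x i : ℝ)|)) := by
        gcongr
        exact hCe _ (by positivity)
    _ ≤ (2 * d) ^ φ * (C * ∑ i, (Real.exp (a / 2 * x i) + Real.exp (a / 2 * -x i))) := by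
        gcongr
        exact h2.trans (Finset.single_le_sum
          (f := fun i => Real.exp (a / 2 * x i) + Real.exp (a / 2 * -x i))
          (fun j _ => by positivity) (Finset.mem_univ i))
    _ = _ := by ring

/-- The constant precedes the triple, so it is uniform in `z`. By symmetry each of the `2d`
exponential sums equals the one along `e_1`. -/
theorem OZBounds.exists_moment_le [NeZero d] {φ : ℝ} (hφ : 0 ≤ φ) :
    ∃ C : ℝ, 0 ≤ C ∧ ∀ {M K ζ : ℝ} {S J h : (Fin d → ℤ) → ℝ}, OZBounds M K ζ S J h →
      (Summable fun x => S x * (mass S * ‖toE x‖) ^ φ) ∧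
        ∑' x, S x * (mass S * ‖toE x‖) ^ φ ≤ C * expSum S (mass S / 2) := by
  obtain ⟨C, hC, hCb⟩ := exists_norm_rpow_le_sum_exp (d := d) hφ
  refine ⟨C * (d * 2), by positivity, fun {M K ζ S J h} H => ?_⟩
  have hm := H.decay.mass_pos
  have hsymm := H.decay.symm
  have hs := H.summable_S_exp (t := mass S / 2) (by positivity) (by linarith)
  have hsi : ∀ i, Summable fun x => S x * Real.exp (mass S / 2 * x i) := fun i =>
    hsymm.summable_coord (fun n => Real.exp (mass S / 2 * n)) 0 i hs
  have hti : ∀ i, ∑' x, S x * Real.exp (mass S / 2 * x i) = expSum S (mass S / 2) := fun i =>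
    hsymm.tsum_coord (fun n => Real.exp (mass S / 2 * n)) 0 i
  have hsi' : ∀ i, Summable fun x => S x * Real.exp (mass S / 2 * -x i) := fun i => by
    simpa using hsymm.summable_neg_coord (fun n => Real.exp (mass S / 2 * n)) i (hsi i)
  have hti' : ∀ i, ∑' x, S x * Real.exp (mass S / 2 * -x i) = expSum S (mass S / 2) := fun i => by
    simpa [hti i] using hsymm.tsum_neg_coord (fun n => Real.exp (mass S / 2 * n)) i
  have hle : ∀ x, S x * (mass S * ‖toE x‖) ^ φ ≤
      C * ∑ i, (S x * Real.exp (mass S / 2 * x i) + S x * Real.exp (mass S / 2 * -x i)) :=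
    fun x => by
      refine (mul_le_mul_of_nonneg_left (hCb (mass S) x hm.le) (H.decay.nonneg x)).trans_eq ?_
      simp_rw [← mul_add]
      rw [← Finset.mul_sum]
      ring
  have hsum : Summable fun x => C * ∑ i, (S x * Real.exp (mass S / 2 * x i) +
      S x * Real.exp (mass S / 2 * -x i)) :=
    (summable_sum fun i _ => (hsi i).add (hsi' i)).mul_left C
  have hs0 : Summable fun x => S x * (mass S * ‖toE x‖) ^ φ :=
    Summable.of_nonneg_of_le (fun x => mul_nonneg (H.decay.nonneg x) (by positivity)) hle hsum
  refine ⟨hs0, (hs0.tsum_le_tsum hle hsum).trans_eq ?_⟩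
  rw [tsum_mul_left, Summable.tsum_finsetSum fun i _ => (hsi i).add (hsi' i)]
  have : ∀ i, ∑' x, (S x * Real.exp (mass S / 2 * x i) + S x * Real.exp (mass S / 2 * -x i)) =
      2 * expSum S (mass S / 2) := fun i => by
    rw [(hsi i).tsum_add (hsi' i), hti, hti']; ring
  rw [Finset.sum_congr rfl fun i _ => this i]
  simp
  ring

theorem OZBounds.summable_moment [NeZero d] {M K ζ φ : ℝ} {S J h : (Fin d → ℤ) → ℝ}
    (H : OZBounds M K ζ S J h) (hφ : 0 ≤ φ) : Summable fun x => ‖toE x‖ ^ φ * S x := by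
  obtain ⟨C, -, hC⟩ := OZBounds.exists_moment_le (d := d) hφ
  have hm := H.decay.mass_pos
  have hmφ : mass S ^ φ ≠ 0 := (Real.rpow_pos_of_pos hm φ).ne'
  refine ((hC H).1.mul_left (mass S ^ φ)⁻¹).congr fun x => ?_
  rw [Real.mul_rpow hm.le (norm_nonneg _)]
  field_simp

/-! ### Asymptotics along a family of parameters -/

theorem tendsto_of_abs_sub_le {ι : Type*} {l : Filter ι} {f g b : ι → ℝ} {a : ℝ}
    (hfg : ∀ᶠ i in l, |f i - g i| ≤ b i) (hb : Tendsto b l (𝓝 0)) (hg : Tendsto g l (𝓝 a)) :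
    Tendsto f l (𝓝 a) := by
  have h : Tendsto (fun i => f i - g i) l (𝓝 0) := squeeze_zero_norm' hfg hb
  simpa using h.add hg

section Family

variable [NeZero d] {ι : Type*} {l : Filter ι} {M K ζ s H₀ : ℝ} {S J h : ι → (Fin d → ℤ) → ℝ}

/-- A family of solutions with uniform bounds and vanishing mass, along which `σ` and `ĥ(0)`
converge. -/
structure NearCritical (l : Filter ι) (M K ζ s H₀ : ℝ) (S J h : ι → (Fin d → ℤ) → ℝ) : Prop where
  K_pos : 0 < K
  ζ_pos : 0 < ζ
  bounds : ∀ᶠ i in l, OZBounds M K ζ (S i) (J i) (h i)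
  mass_tendsto : Tendsto (fun i => mass (S i)) l (𝓝 0)
  sigma_tendsto : Tendsto (fun i => sigma (J i)) l (𝓝 s)
  hat_tendsto : Tendsto (fun i => ∑' x, h i x) l (𝓝 H₀)

namespace NearCritical

theorem M_pos [l.NeBot] (N : NearCritical l M K ζ s H₀ S J h) : 0 < M :=
  let ⟨_, hi⟩ := N.bounds.exists
  hi.M_pos

theorem H₀_pos [l.NeBot] (N : NearCritical l M K ζ s H₀ S J h) : 0 < H₀ :=
  (inv_pos.2 N.M_pos).trans_le <| ge_of_tendsto N.hat_tendsto <|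
    N.bounds.mono fun _ hi => hi.inv_le_tsum

theorem tendsto_variance (N : NearCritical l M K ζ s H₀ S J h) :
    Tendsto (fun i => (∑' x, ‖toE x‖ ^ 2 * J i x) / d) l (𝓝 (s ^ 2 / d)) := by
  refine ((N.sigma_tendsto.pow 2).congr' ?_).div_const _
  filter_upwards [N.bounds] with i hi
  exact hi.sigma_sq N.ζ_pos N.K_pos.le

theorem s_sq_pos [l.NeBot] (N : NearCritical l M K ζ s H₀ S J h) : 0 < s ^ 2 := by
  have hd : (0 : ℝ) < d := by exact_mod_cast NeZero.pos d
  have hK := N.K_pos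
  refine lt_of_lt_of_le (show 0 < 2 * d * K by positivity) ?_
  refine ge_of_tendsto (N.sigma_tendsto.pow 2) ?_
  filter_upwards [N.bounds] with i hi
  rw [hi.sigma_sq N.ζ_pos N.K_pos.le]
  exact hi.le_second_moment N.ζ_pos

theorem tendsto_mass_rpow (N : NearCritical l M K ζ s H₀ S J h) {η : ℝ} (hη : 0 < η) (c : ℝ) :
    Tendsto (fun i => mass (S i) ^ η * c) l (𝓝 0) := by
  have := (N.mass_tendsto.rpow_const (p := η) (Or.inr hη.le)).mul_const c
  rwa [Real.zero_rpow hη.ne', zero_mul] at this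

/-- Second order expansion of the exponential sums of `J` at `t = c m`, `0 ≤ c ≤ 1`. -/
theorem tendsto_expSum_J (N : NearCritical l M K ζ s H₀ S J h) {c : ℝ} (h0 : 0 ≤ c) (h1 : c ≤ 1) :
    Tendsto (fun i => (expSum (J i) (c * mass (S i)) - ∑' x, J i x) / mass (S i) ^ 2) l
      (𝓝 (c ^ 2 / 2 * (s ^ 2 / d))) := by
  have hη : 0 < min ζ 1 := lt_min N.ζ_pos one_pos
  refine tendsto_of_abs_sub_le (b := fun i => mass (S i) ^ min ζ 1 * (c ^ (2 + min ζ 1) * M)) ?_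
    (N.tendsto_mass_rpow hη _) (N.tendsto_variance.const_mul (c ^ 2 / 2))
  filter_upwards [N.bounds] with i hi
  have hm := hi.decay.mass_pos
  have hcm : 0 ≤ c * mass (S i) := by positivity
  have hcl : c * mass (S i) ≤ mass (S i) := mul_le_of_le_one_left hm.le h1
  have hQ := (hi.bounds _ (hi.decay.e1_mem_closure hcm hcl)).1
  have key := abs_expSum_sub_le hi.oz.J_symm hi.oz.J_summable (hi.summable_sq N.ζ_pos.le)
    hi.M_pos.le hcm hη.le (min_le_right _ _) (min_le_left _ _) hQ.Q_norm hQ.Q_moment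
  rw [Real.mul_rpow h0 hm.le, Real.rpow_add hm, Real.rpow_two] at key
  have hm2 : 0 < mass (S i) ^ 2 := by positivity
  have hid : (expSum (J i) (c * mass (S i)) - ∑' x, J i x) / mass (S i) ^ 2 -
      c ^ 2 / 2 * ((∑' x, ‖toE x‖ ^ 2 * J i x) / d) =
      (expSum (J i) (c * mass (S i)) - ∑' x, J i x -
        (c * mass (S i)) ^ 2 / 2 * ((∑' x, ‖toE x‖ ^ 2 * J i x) / d)) / mass (S i) ^ 2 := by
    field_simp
  rw [hid, abs_div, abs_of_pos hm2, div_le_iff₀ hm2]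
  exact key.trans_eq (by ring)

theorem tendsto_cosSum_J (N : NearCritical l M K ζ s H₀ S J h) (ξ : EuclideanSpace ℝ (Fin d)) :
    Tendsto (fun i => (∑' x, J i x - cosSum (J i) (mass (S i) • ξ)) / mass (S i) ^ 2) l
      (𝓝 (‖ξ‖ ^ 2 / 2 * (s ^ 2 / d))) := by
  have hη : 0 < min ζ 1 := lt_min N.ζ_pos one_pos
  refine tendsto_of_abs_sub_le (b := fun i => mass (S i) ^ min ζ 1 * (‖ξ‖ ^ (2 + min ζ 1) * M)) ?_
    (N.tendsto_mass_rpow hη _) (N.tendsto_variance.const_mul (‖ξ‖ ^ 2 / 2))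
  filter_upwards [N.bounds] with i hi
  have hm := hi.decay.mass_pos
  have key := abs_sub_cosSum_sub_le hi.oz.J_symm hi.oz.J_summable (hi.summable_sq N.ζ_pos.le)
    hi.M_pos.le hη.le (min_le_right _ _) (min_le_left _ _) hi.qClass.Q_moment (mass (S i) • ξ)
  rw [norm_smul, Real.norm_of_nonneg hm.le, Real.mul_rpow hm.le (norm_nonneg _), Real.rpow_add hm,
    Real.rpow_two] at key
  have hm2 : 0 < mass (S i) ^ 2 := by positivity
  have hid : (∑' x, J i x - cosSum (J i) (mass (S i) • ξ)) / mass (S i) ^ 2 -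
      ‖ξ‖ ^ 2 / 2 * ((∑' x, ‖toE x‖ ^ 2 * J i x) / d) =
      (∑' x, J i x - cosSum (J i) (mass (S i) • ξ) -
        (mass (S i) * ‖ξ‖) ^ 2 / 2 * ((∑' x, ‖toE x‖ ^ 2 * J i x) / d)) / mass (S i) ^ 2 := by
    field_simp
  rw [hid, abs_div, abs_of_pos hm2, div_le_iff₀ hm2]
  exact key.trans_eq (by ring)

theorem tendsto_cosSum_h (N : NearCritical l M K ζ s H₀ S J h) (ξ : EuclideanSpace ℝ (Fin d)) :
    Tendsto (fun i => cosSum (h i) (mass (S i) • ξ)) l (𝓝 H₀) := by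
  have hη : 0 < min ζ 1 := lt_min N.ζ_pos one_pos
  refine tendsto_of_abs_sub_le (b := fun i => mass (S i) ^ min ζ 1 * (2 * ‖ξ‖ ^ min ζ 1 * M)) ?_
    (N.tendsto_mass_rpow hη _) N.hat_tendsto
  filter_upwards [N.bounds] with i hi
  have hm := hi.decay.mass_pos
  have key := abs_sub_cosSum_le hi.oz.h_summable hi.M_pos.le hη (min_le_right _ _)
    (min_le_left _ _) hi.qClass.g_moment (mass (S i) • ξ)
  rw [norm_smul, Real.norm_of_nonneg hm.le, Real.mul_rpow hm.le (norm_nonneg _)] at key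
  rw [abs_sub_comm]
  exact key.trans_eq (by ring)

/-- Replacing `1` by the exponential sum of `J` at the mass splits the numerator into a real-tilt
increment, which contributes the `1`, and an imaginary-tilt increment, which contributes `|ξ|²`. -/
theorem tendsto_one_sub_cosSum_J (N : NearCritical l M K ζ s H₀ S J h)
    (ξ : EuclideanSpace ℝ (Fin d)) :
    Tendsto (fun i => (1 - cosSum (J i) (mass (S i) • ξ)) / mass (S i) ^ 2) l
      (𝓝 ((1 + ‖ξ‖ ^ 2) / 2 * (s ^ 2 / d))) := by
  have h1 := (N.tendsto_expSum_J zero_le_one le_rfl).add (N.tendsto_cosSum_J ξ)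
  rw [show (1 : ℝ) ^ 2 / 2 * (s ^ 2 / d) + ‖ξ‖ ^ 2 / 2 * (s ^ 2 / d) =
    (1 + ‖ξ‖ ^ 2) / 2 * (s ^ 2 / d) by ring] at h1
  refine h1.congr' ?_
  filter_upwards [N.bounds] with i hi
  rw [one_mul, hi.expSum_J_mass]
  ring

/-- The rescaled Fourier transform of `S` converges. -/
theorem tendsto_cosSum_S [l.NeBot] (N : NearCritical l M K ζ s H₀ S J h)
    (ξ : EuclideanSpace ℝ (Fin d)) :
    Tendsto (fun i => mass (S i) ^ 2 * cosSum (S i) (mass (S i) • ξ)) l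
      (𝓝 (2 * (d * H₀ / s ^ 2) / (1 + ‖ξ‖ ^ 2))) := by
  have hd : (0 : ℝ) < d := by exact_mod_cast NeZero.pos d
  have hs := N.s_sq_pos
  have hlim : 0 < (1 + ‖ξ‖ ^ 2) / 2 * (s ^ 2 / d) := by positivity
  have h1 := (N.tendsto_cosSum_h ξ).div (N.tendsto_one_sub_cosSum_J ξ) hlim.ne'
  rw [show H₀ / ((1 + ‖ξ‖ ^ 2) / 2 * (s ^ 2 / d)) = 2 * (d * H₀ / s ^ 2) / (1 + ‖ξ‖ ^ 2) by
    have : 1 + ‖ξ‖ ^ 2 ≠ 0 := by positivity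
    have : s ≠ 0 := by rintro rfl; simp at hs
    field_simp] at h1
  refine h1.congr' ?_
  filter_upwards [N.bounds, (N.tendsto_one_sub_cosSum_J ξ).eventually_const_lt hlim] with i hi hpos
  have hm := hi.decay.mass_pos
  have hne : 1 - cosSum (J i) (mass (S i) • ξ) ≠ 0 := fun h0 => by
    rw [h0, zero_div] at hpos; exact lt_irrefl _ hpos
  rw [Pi.div_apply, ← hi.cosSum_mul]
  field_simp

theorem tendsto_susceptibility [l.NeBot] (N : NearCritical l M K ζ s H₀ S J h) :
    Tendsto (fun i => mass (S i) ^ 2 * susceptibility (S i)) l (𝓝 (2 * (d * H₀ / s ^ 2))) := by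
  simpa [cosSum_zero, susceptibility] using N.tendsto_cosSum_S 0

theorem limit_pos [l.NeBot] (N : NearCritical l M K ζ s H₀ S J h) : 0 < d * H₀ / s ^ 2 := by
  have hd : (0 : ℝ) < d := by exact_mod_cast NeZero.pos d
  have h1 := N.s_sq_pos
  have h2 := N.H₀_pos
  positivity

theorem eventually_susceptibility_pos [l.NeBot] (N : NearCritical l M K ζ s H₀ S J h) :
    ∀ᶠ i in l, 0 < susceptibility (S i) := by
  have hlim := N.limit_pos
  filter_upwards [N.bounds, N.tendsto_susceptibility.eventually_const_lt
    (show 0 < 2 * (d * H₀ / s ^ 2) by positivity)] with i hi hpos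
  exact pos_of_mul_pos_right hpos (by positivity)

/-- At half the mass, the tilted susceptibility is of order `m⁻²`. -/
theorem exists_expSum_S_le [l.NeBot] (N : NearCritical l M K ζ s H₀ S J h) :
    ∃ C, ∀ᶠ i in l, mass (S i) ^ 2 * expSum (S i) (mass (S i) / 2) ≤ C := by
  have hd : (0 : ℝ) < d := by exact_mod_cast NeZero.pos d
  have hs := N.s_sq_pos
  have hlim := (N.tendsto_expSum_J zero_le_one le_rfl).sub
    (N.tendsto_expSum_J (c := 1 / 2) (by norm_num) (by norm_num))
  have hpos : 0 < s ^ 2 / d := by positivity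
  -- Expanding at `m` and at `m/2`, the gap `1 - ∑ J(x) e^{m x_1 / 2}` over `m²` tends to `(1/2 -
  -- 1/8) s²/d`, so it eventually exceeds `s²/(4d)`; the tilted `h` has sum at most `M`.
  refine ⟨M / (s ^ 2 / d / 4), ?_⟩
  filter_upwards [N.bounds, hlim.eventually_const_lt
    (show s ^ 2 / d / 4 < 1 ^ 2 / 2 * (s ^ 2 / d) - (1 / 2) ^ 2 / 2 * (s ^ 2 / d) by linarith)]
    with i hi hgt
  have hm := hi.decay.mass_pos
  rw [one_mul, hi.expSum_J_mass, ← sub_div, sub_sub_sub_cancel_right,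
    show 1 / 2 * mass (S i) = mass (S i) / 2 by ring, lt_div_iff₀ (by positivity)] at hgt
  have e1 := hi.expSum_mul (t := mass (S i) / 2) (by positivity) (by linarith)
  have e2 := (hi.summable_h_exp (t := mass (S i) / 2) (by positivity) (by linarith)).2
  rw [le_div_iff₀ (by positivity)]
  have e3 := mul_le_mul_of_nonneg_left hgt.le (hi.expSum_S_nonneg (mass (S i) / 2))
  linarith

/-- The normalised moments, rescaled by the mass, converge to those of the Green function. -/
theorem tendsto_normalized_moment [l.NeBot] [l.IsCountablyGenerated]
    (N : NearCritical l M K ζ s H₀ S J h) {φ : ℝ} (hφ : 0 ≤ φ) :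
    Tendsto (fun i => mass (S i) ^ φ * (1 / susceptibility (S i) * moment φ (S i))) l
      (𝓝 (constA d φ / 2)) := by
  have hlim := N.limit_pos
  set A := 2 * (d * H₀ / s ^ 2) with hA
  have hApos : 0 < A := by positivity
  -- The exponent is `2φ` because the test function `|y|^φ` needs a bounded second moment.
  obtain ⟨C₁, hC₁0, hC₁⟩ := OZBounds.exists_moment_le (d := d) (φ := 2 * φ) (by positivity)
  obtain ⟨C₂, hC₂⟩ := N.exists_expSum_S_le
  have hnorm : ∀ (i : ι) (x : Fin d → ℤ), 0 ≤ mass (S i) →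
      ‖mass (S i) • toE x‖ = mass (S i) * ‖toE x‖ := fun i x hm => by
    rw [norm_smul, Real.norm_of_nonneg hm]
  have hsq : ∀ y : ℝ, 0 ≤ y → (y ^ φ) ^ 2 = y ^ (2 * φ) := fun y hy => by
    rw [← Real.rpow_two, ← Real.rpow_mul hy, mul_comm]
  -- In the bound `C₁ * C₂ / (A / 2)`, the numerator controls `m²` times the unnormalised moment,
  -- and `A / 2` is an eventual lower bound for `m² χ`.
  have key := tendsto_tsum_of_tendsto_charFun (l := l)
    (p := fun i x => 1 / susceptibility (S i) * S i x) (m := fun i => mass (S i))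
    (Q := ⟨greenLaw d, inferInstance⟩) ?_ ?_ (f := fun y => ‖y‖ ^ φ) ?_ ?_
    (C := C₁ * C₂ / (A / 2)) ?_ ?_
  · change Tendsto _ l (𝓝 (∫ y, ‖y‖ ^ φ ∂greenLaw d)) at key
    rw [integral_norm_rpow_greenLaw] at key
    refine key.congr' ?_
    filter_upwards [N.bounds] with i hi
    have hm := hi.decay.mass_pos
    rw [moment, ← tsum_mul_left, ← tsum_mul_left]
    refine tsum_congr fun x => ?_
    rw [hnorm i x hm.le, Real.mul_rpow hm.le (norm_nonneg _)]
    ring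
  · filter_upwards [N.bounds, N.eventually_susceptibility_pos] with i hi hχ
    refine ⟨fun x => mul_nonneg (by positivity) (hi.decay.nonneg x), ?_⟩
    have := hi.decay.summable.hasSum.mul_left (1 / susceptibility (S i))
    rwa [← susceptibility, one_div_mul_cancel hχ.ne'] at this
  · intro ξ
    change Tendsto _ _ (𝓝 (charFun (greenLaw d) ξ))
    rw [charFun_greenLaw]
    have h1 := (N.tendsto_cosSum_S ξ).div N.tendsto_susceptibility hApos.ne'
    have h2 := (Complex.continuous_ofReal.tendsto _).comp h1
    have h3 : ((A / (1 + ‖ξ‖ ^ 2) / A : ℝ) : ℂ) = 1 / (1 + (‖ξ‖ : ℂ) ^ 2) := by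
      rw [div_right_comm, div_self hApos.ne']
      push_cast
      rfl
    rw [h3] at h2
    refine h2.congr' ?_
    filter_upwards [N.bounds, N.eventually_susceptibility_pos] with i hi hχ
    have hm := hi.decay.mass_pos
    have hterm : ∀ x : Fin d → ℤ, (1 / susceptibility (S i) * S i x) •
        Complex.exp ((inner ℝ (mass (S i) • toE x) ξ : ℝ) * Complex.I) =
        ((1 / susceptibility (S i) : ℝ) : ℂ) * ((S i x : ℂ) *
          Complex.exp ((inner ℝ (toE x) (mass (S i) • ξ) : ℝ) * Complex.I)) := fun x => by
      rw [Complex.real_smul, real_inner_smul_left, real_inner_smul_right]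
      push_cast
      ring
    simp_rw [hterm]
    rw [tsum_mul_left, hi.decay.symm.tsum_mul_cexp hi.decay.summable.abs, ← Complex.ofReal_mul,
      Function.comp_apply, Pi.div_apply]
    congr 1
    field_simp
  · exact continuous_norm.rpow_const fun y => Or.inr hφ
  · intro y; positivity
  · filter_upwards [N.bounds, N.eventually_susceptibility_pos, hC₂,
      N.tendsto_susceptibility.eventually_const_lt (show A / 2 < A by linarith)] with i hi hχ hC hgt
    have hm := hi.decay.mass_pos
    obtain ⟨b1, b2⟩ := hC₁ hi
    have hterm : ∀ x : Fin d → ℤ,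
        1 / susceptibility (S i) * S i x * (‖mass (S i) • toE x‖ ^ φ) ^ 2 =
        1 / susceptibility (S i) * (S i x * (mass (S i) * ‖toE x‖) ^ (2 * φ)) := fun x => by
      rw [hnorm i x hm.le, hsq _ (by positivity), mul_assoc]
    simp_rw [hterm]
    refine ⟨b1.mul_left _, ?_⟩
    rw [tsum_mul_left, one_div_mul_eq_div, div_le_div_iff₀ hχ (by positivity)]
    have hm2 : 0 < mass (S i) ^ 2 := by positivity
    have e1 : 0 ≤ ∑' x, S i x * (mass (S i) * ‖toE x‖) ^ (2 * φ) :=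
      tsum_nonneg fun x => mul_nonneg (hi.decay.nonneg x) (by positivity)
    have e2 : mass (S i) ^ 2 * (∑' x, S i x * (mass (S i) * ‖toE x‖) ^ (2 * φ)) ≤ C₁ * C₂ := by
      calc _ ≤ mass (S i) ^ 2 * (C₁ * expSum (S i) (mass (S i) / 2)) := by gcongr
        _ = C₁ * (mass (S i) ^ 2 * expSum (S i) (mass (S i) / 2)) := by ring
        _ ≤ _ := by gcongr
    calc (∑' x, S i x * (mass (S i) * ‖toE x‖) ^ (2 * φ)) * (A / 2)
        ≤ (∑' x, S i x * (mass (S i) * ‖toE x‖) ^ (2 * φ)) *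
          (mass (S i) ^ 2 * susceptibility (S i)) := by gcongr
      _ = mass (S i) ^ 2 * (∑' x, S i x * (mass (S i) * ‖toE x‖) ^ (2 * φ)) *
          susceptibility (S i) := by ring
      _ ≤ _ := by gcongr
  · simp_rw [hsq _ (norm_nonneg _)]
    exact integrable_norm_rpow_greenLaw (by positivity)

/-- Multiplying the limits of `m² χ` and of the normalised moment cancels `χ`. -/
theorem tendsto_moment [l.NeBot] [l.IsCountablyGenerated]
    (N : NearCritical l M K ζ s H₀ S J h) {φ : ℝ} (hφ : 0 ≤ φ) :
    Tendsto (fun i => mass (S i) ^ (2 + φ) * moment φ (S i)) l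
      (𝓝 (constA d φ * (d * H₀ / s ^ 2))) := by
  have h1 := N.tendsto_susceptibility.mul (N.tendsto_normalized_moment hφ)
  rw [show 2 * (d * H₀ / s ^ 2) * (constA d φ / 2) = constA d φ * (d * H₀ / s ^ 2) by ring] at h1
  refine h1.congr' ?_
  filter_upwards [N.bounds, N.eventually_susceptibility_pos] with i hi hχ
  rw [Real.rpow_add hi.decay.mass_pos, Real.rpow_two]
  field_simp

theorem isEquivalent_of_mul_tendsto {u v w : ι → ℝ} {a : ℝ} (ha : a ≠ 0)
    (hw : ∀ᶠ i in l, w i ≠ 0) (hv : ∀ᶠ i in l, v i = a * (1 / w i))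
    (hu : Tendsto (fun i => w i * u i) l (𝓝 a)) : Asymptotics.IsEquivalent l u v := by
  refine (Asymptotics.isEquivalent_iff_tendsto_one ?_).2 ?_
  · filter_upwards [hw, hv] with i hi hvi
    rw [hvi]; positivity
  · have := hu.div_const a
    rw [div_self ha] at this
    refine this.congr' ?_
    filter_upwards [hw, hv] with i hi hvi
    rw [Pi.div_apply, hvi]
    field_simp

theorem isEquivalent_moment [l.NeBot] [l.IsCountablyGenerated]
    (N : NearCritical l M K ζ s H₀ S J h) {φ : ℝ} (hφ : 0 ≤ φ) :
    Asymptotics.IsEquivalent l (fun i => moment φ (S i))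
      (fun i => constA d φ * (d * H₀ / s ^ 2) * (1 / mass (S i) ^ (2 + φ))) :=
  isEquivalent_of_mul_tendsto (mul_pos (constA_pos hφ) N.limit_pos).ne'
    (N.bounds.mono fun _ hi => (Real.rpow_pos_of_pos hi.decay.mass_pos _).ne')
    (.of_forall fun _ => rfl) (N.tendsto_moment hφ)

theorem tendsto_corrLength [l.NeBot] [l.IsCountablyGenerated]
    (N : NearCritical l M K ζ s H₀ S J h) {φ : ℝ} (hφ : 0 < φ) :
    Tendsto (fun i => mass (S i) * corrLength φ (S i)) l
      (𝓝 ((constA d φ / constA d 0) ^ (1 / φ))) := by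
  have h1 := (N.tendsto_normalized_moment hφ.le).rpow_const (p := 1 / φ)
    (Or.inr (by positivity))
  rw [constA_zero]
  refine h1.congr' ?_
  filter_upwards [N.bounds, N.eventually_susceptibility_pos] with i hi hχ
  have hm := hi.decay.mass_pos
  have hmom : 0 ≤ moment φ (S i) :=
    tsum_nonneg fun x => mul_nonneg (by positivity) (hi.decay.nonneg x)
  rw [corrLength, Real.mul_rpow (by positivity) (by positivity), ← Real.rpow_mul hm.le,
    mul_one_div_cancel hφ.ne', Real.rpow_one]

theorem isEquivalent_corrLength [l.NeBot] [l.IsCountablyGenerated]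
    (N : NearCritical l M K ζ s H₀ S J h) {φ : ℝ} (hφ : 0 < φ) :
    Asymptotics.IsEquivalent l (fun i => corrLength φ (S i))
      (fun i => (constA d φ / constA d 0) ^ (1 / φ) * (1 / mass (S i))) :=
  isEquivalent_of_mul_tendsto
    (Real.rpow_pos_of_pos (div_pos (constA_pos hφ.le) (constA_pos le_rfl)) _).ne'
    (N.bounds.mono fun _ hi => hi.decay.mass_pos.ne')
    (.of_forall fun _ => rfl) (N.tendsto_corrLength hφ)

end NearCritical

end Family

/-! ### Closed forms for the universal constants and ratios. -/

theorem constA_ratio_rpow [NeZero d] {φ : ℝ} (hφ : 0 < φ) :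
    (constA d φ / constA d 0) ^ (1 / φ) =
      2 * (Real.Gamma ((φ + 2) / 2) * Real.Gamma ((φ + d) / 2) /
        Real.Gamma ((d : ℝ) / 2)) ^ (1 / φ) := by
  have hd : (0 : ℝ) < d := by exact_mod_cast NeZero.pos d
  have h1 := Real.Gamma_pos_of_pos (show 0 < (φ + 2) / 2 by positivity)
  have h2 := Real.Gamma_pos_of_pos (show 0 < (φ + d) / 2 by positivity)
  have h3 := Real.Gamma_pos_of_pos (show 0 < (d : ℝ) / 2 by positivity)
  have h4 : constA d φ / constA d 0 = 2 ^ φ * (Real.Gamma ((φ + 2) / 2) *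
      Real.Gamma ((φ + d) / 2) / Real.Gamma ((d : ℝ) / 2)) := by
    rw [constA_zero, constA_eq hφ.le, Real.rpow_add_one two_ne_zero]
    ring
  rw [h4, Real.mul_rpow (by positivity) (by positivity), ← Real.rpow_mul two_pos.le,
    mul_one_div_cancel hφ.ne', Real.rpow_one]

theorem constA_ratio_rpow_div [NeZero d] {φ ψ : ℝ} (hφ : 0 < φ) (hψ : 0 < ψ) :
    (constA d φ / constA d 0) ^ (1 / φ) / (constA d ψ / constA d 0) ^ (1 / ψ) =
      (Real.Gamma ((φ + 2) / 2) * Real.Gamma ((φ + d) / 2)) ^ (1 / φ) /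
          (Real.Gamma ((ψ + 2) / 2) * Real.Gamma ((ψ + d) / 2)) ^ (1 / ψ) *
          Real.Gamma ((d : ℝ) / 2) ^ (1 / ψ - 1 / φ) := by
  have hd : (0 : ℝ) < d := by exact_mod_cast NeZero.pos d
  have h1 := Real.Gamma_pos_of_pos (show 0 < (φ + 2) / 2 by positivity)
  have h2 := Real.Gamma_pos_of_pos (show 0 < (φ + d) / 2 by positivity)
  have h1' := Real.Gamma_pos_of_pos (show 0 < (ψ + 2) / 2 by positivity)
  have h2' := Real.Gamma_pos_of_pos (show 0 < (ψ + d) / 2 by positivity)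
  have h3 := Real.Gamma_pos_of_pos (show 0 < (d : ℝ) / 2 by positivity)
  rw [constA_ratio_rpow hφ, constA_ratio_rpow hψ, Real.div_rpow (by positivity) h3.le,
    Real.div_rpow (by positivity) h3.le, Real.rpow_sub h3]
  have g1 := (Real.rpow_pos_of_pos (mul_pos h1' h2') (1 / ψ)).ne'
  have g2 := (Real.rpow_pos_of_pos h3 (1 / φ)).ne'
  have g3 := (Real.rpow_pos_of_pos h3 (1 / ψ)).ne'
  generalize (Real.Gamma ((ψ + 2) / 2) * Real.Gamma ((ψ + d) / 2)) ^ (1 / ψ) = b at *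
  generalize (Real.Gamma ((φ + 2) / 2) * Real.Gamma ((φ + d) / 2)) ^ (1 / φ) = a at *
  generalize Real.Gamma ((d : ℝ) / 2) ^ (1 / φ) = c at *
  generalize Real.Gamma ((d : ℝ) / 2) ^ (1 / ψ) = e at *
  field_simp

theorem NearCritical.tendsto_corrLength_ratio [NeZero d] {ι : Type*} {l : Filter ι}
    [l.NeBot] [l.IsCountablyGenerated] {M K ζ s H₀ : ℝ} {S J h : ι → (Fin d → ℤ) → ℝ}
    (N : NearCritical l M K ζ s H₀ S J h) {φ ψ : ℝ} (hφ : 0 < φ) (hψ : 0 < ψ) :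
    Tendsto (fun i => corrLength φ (S i) / corrLength ψ (S i)) l
      (𝓝 ((Real.Gamma ((φ + 2) / 2) * Real.Gamma ((φ + d) / 2)) ^ (1 / φ) /
          (Real.Gamma ((ψ + 2) / 2) * Real.Gamma ((ψ + d) / 2)) ^ (1 / ψ) *
          Real.Gamma ((d : ℝ) / 2) ^ (1 / ψ - 1 / φ))) := by
  have h1 := (N.tendsto_corrLength hφ).div (N.tendsto_corrLength hψ)
    (Real.rpow_pos_of_pos (div_pos (constA_pos hψ.le) (constA_pos le_rfl)) _).ne'
  rw [constA_ratio_rpow_div hφ hψ] at h1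
  refine h1.congr' ?_
  filter_upwards [N.bounds] with i hi
  exact mul_div_mul_left _ _ hi.decay.mass_pos.ne'

end OZ

theorem theorem2p4 (d : ℕ) [NeZero d] (zc δ : ℝ) (hδ : 0 < δ)
    (S J h : ℝ → (Fin d → ℤ) → ℝ)
    (hS : ∀ z ∈ Set.Ico (zc - δ) zc, OZ.ExpDecay (S z))
    (hOZ : ∀ z ∈ Set.Ico (zc - δ) zc, OZ.OZEquation (S z) (J z) (h z))
    (hm : Tendsto (fun z => OZ.mass (S z)) (𝓝[<] zc) (𝓝 0))
    (M K ζ : ℝ) (hM : 0 < M) (hK : 0 < K) (hζ : 0 < ζ)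
    (hQ : ∀ z ∈ Set.Ico (zc - δ) zc, ∀ μ ∈ closure (OZ.Omega (S z)),
      OZ.QClass M K ζ (OZ.tilt (J z) μ) (OZ.tilt (h z) μ) ∧
        M⁻¹ ≤ OZ.hatZero (OZ.tilt (h z) μ))
    (hσ : Tendsto (fun z => OZ.sigma (J z)) (𝓝[<] zc) (𝓝 (OZ.sigma (J zc))))
    (hh : Tendsto (fun z => OZ.hatZero (h z)) (𝓝[<] zc) (𝓝 (OZ.hatZero (h zc)))) :
    -- the constants
    (∀ φ : ℝ, 0 ≤ φ →
      OZ.constA d φ = (2 : ℝ) ^ (φ + 1) *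
        (Real.Gamma ((φ + 2) / 2) * Real.Gamma ((φ + d) / 2)) / Real.Gamma ((d : ℝ) / 2)) ∧
    -- the moments
    (∀ φ : ℝ, 0 ≤ φ →
      (∀ z ∈ Set.Ico (zc - δ) zc, Summable (fun x => ‖OZ.toE x‖ ^ φ * S z x)) ∧
      Asymptotics.IsEquivalent (𝓝[<] zc) (fun z => OZ.moment φ (S z))
        (fun z => OZ.constA d φ * ((d : ℝ) * OZ.hatZero (h zc) / OZ.sigma (J zc) ^ 2) *
          (1 / OZ.mass (S z) ^ (2 + φ)))) ∧
    -- the correlation lengths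
    (∀ φ : ℝ, 0 < φ →
      Asymptotics.IsEquivalent (𝓝[<] zc) (fun z => OZ.corrLength φ (S z))
        (fun z => (OZ.constA d φ / OZ.constA d 0) ^ (1 / φ) * (1 / OZ.mass (S z))) ∧
      (OZ.constA d φ / OZ.constA d 0) ^ (1 / φ) =
        2 * (Real.Gamma ((φ + 2) / 2) * Real.Gamma ((φ + d) / 2) /
          Real.Gamma ((d : ℝ) / 2)) ^ (1 / φ)) ∧
    -- the universal ratios
    (∀ φ ψ : ℝ, 0 < φ → 0 < ψ →
      Tendsto (fun z => OZ.corrLength φ (S z) / OZ.corrLength ψ (S z)) (𝓝[<] zc)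
        (𝓝 ((Real.Gamma ((φ + 2) / 2) * Real.Gamma ((φ + d) / 2)) ^ (1 / φ) /
          (Real.Gamma ((ψ + 2) / 2) * Real.Gamma ((ψ + d) / 2)) ^ (1 / ψ) *
          Real.Gamma ((d : ℝ) / 2) ^ (1 / ψ - 1 / φ)))) := by
  have hH : ∀ z ∈ Set.Ico (zc - δ) zc, OZ.OZBounds M K ζ (S z) (J z) (h z) := fun z hz =>
    ⟨hS z hz, hOZ z hz, hM, hQ z hz⟩
  have N : OZ.NearCritical (𝓝[<] zc) M K ζ (OZ.sigma (J zc)) (OZ.hatZero (h zc)) S J h :=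
    { K_pos := hK
      ζ_pos := hζ
      bounds := by
        filter_upwards [Ico_mem_nhdsLT (sub_lt_self zc hδ)] with z hz using hH z hz
      mass_tendsto := hm
      sigma_tendsto := hσ
      hat_tendsto := by simpa only [OZ.hatZero_eq_tsum] using hh }
  exact ⟨fun φ hφ => OZ.constA_eq hφ,
    fun φ hφ => ⟨fun z hz => (hH z hz).summable_moment hφ, N.isEquivalent_moment hφ⟩,
    fun φ hφ => ⟨N.isEquivalent_corrLength hφ, OZ.constA_ratio_rpow hφ⟩,
    fun φ ψ hφ hψ => N.tendsto_corrLength_ratio hφ hψ⟩
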